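/- Let $k$ be a field, and let $X_1, Q, X_2$ be finite quivers such that $X_1$ and $X_2$ are acyclic (no oriented cycles) and $Q$ is weakly acyclic (its only oriented cycles are compositions of loops). Let $I_1, I_Q, I_2$ be admissible ideals of the path algebras $kX_1, kQ, kX_2$, and put $A_1 = kX_1/I_1$, $\overline B = kQ/I_Q$, $A_2 = kX_2/I_2$. Let $M_1$ be a $\overline B$-$A_1$-bimodule that is projective as a left $\overline B$-module, let $M_2$ be an $A_2$-$\overline B$-bimodule that is projective as a right $\overline B$-module, let $M_{21}$ be an $A_2$-$A_1$-bimodule ($k$ acts centrally on all bimodules; they need not be finitely generated), and let $\rho : M_2\otimes_{\overline B} M_1\to M_{21}$ be a homomorphism of bimodules. Consider the algebra $$A=\begin{pmatrix}A_2 & M_2 & M_{21}\\ 0&\overline B& M_1\\ 0&0&A_1\end{pmatrix},$$ whose multiplication is that of matrices, with the products $M_2\times M_1\to M_{21}$ given by $\rho$, and its subalgebra $$B=\overline B\times kE=\{\operatorname{diag}(c\,1_{A_2},\,b,\,c\,1_{A_1}) : b\in\overline B,\ c\in k\},\qquad E=\operatorname{diag}(1_{A_2},0,1_{A_1}).$$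 Write $B^e=B\otimes_k B^{op}$ and $A^e=A\otimes_k A^{op}$. Then the extension $B\subseteq A$ is strongly proj-bounded, that is: 1. $A/B$ has finite projective dimension as a $B^e$-module; 2. $A/B$ is projective as a left or as a right $B$-module; 3. there is $p\geq 1$ such that $(A/B)^{\otimes_B n}$ is projective as a $B^e$-module for every $n\geq p$; 4. $A$ has finite $(A^e,B^e)$-relative projective dimension: for some $n$ there is an exact sequence $0\to P_n\to\cdots\to P_0\to A\to 0$ of $A^e$-modules in which the kernel of every map is a direct summand as a $B^e$-module, and every $P_i$ is $(A^e,B^e)$-projective (every surjective $A^e$-homomorphism onto $P_i$ that splits over $B^e$ splits over $A^e$). Moreover, if $X_1$ and $X_2$ together have at least two vertices, then $B\subseteq A$ is not a bounded extension, where an extension is called bounded if it satisfies 1, 2 and $(A/B)^{\otimes_B p}=0$ for some $p\geq 1$. -/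

import Mathlib

universe u

open scoped TensorProduct
open MulOpposite (op)

namespace ProjBounded

/-! ### Quivers, path algebras and admissible ideals -/

section PathAlgebra

/-- A quiver is acyclic if it has no oriented cycle: every closed path is trivial. -/
def IsAcyclic (V : Type u) [Quiver.{u} V] : Prop :=
  ∀ (a : V) (p : Quiver.Path a a), p.length = 0

/-- A quiver is weakly acyclic if no oriented cycle passes through two distinct vertices, that is,
the only oriented cycles are compositions of loops. -/
def IsWeaklyAcyclic (V : Type u) [Quiver.{u} V] : Prop :=
  ∀ a b : V, Nonempty (Quiver.Path a b) → Nonempty (Quiver.Path b a) → a = b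

/-- A path of a quiver together with its source and its target. -/
structure QPath (V : Type u) [Quiver.{u} V] where
  src : V
  tgt : V
  path : Quiver.Path src tgt

/-- The path algebra `kQ`: the vector space with basis all the paths of the quiver. -/
def PathAlgebra (k : Type u) [Field k] (V : Type u) [Quiver.{u} V] : Type u := QPath V →₀ k

variable {k : Type u} [Field k] {V : Type u} [Quiver.{u} V]

namespace PathAlgebra

noncomputable instance : AddCommGroup (PathAlgebra k V) :=
  inferInstanceAs (AddCommGroup (QPath V →₀ k))

noncomputable instance : Module k (PathAlgebra k V) :=
  inferInstanceAs (Module k (QPath V →₀ k))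

variable (k V) in
/-- The basis of the path algebra that consists of the paths. -/
noncomputable def basis : Module.Basis (QPath V) k (PathAlgebra k V) :=
  ⟨LinearEquiv.refl k (QPath V →₀ k)⟩

variable (k) in
/-- The basis element given by a path. -/
noncomputable def ofPath (p : QPath V) : PathAlgebra k V := basis k V p

/-- The coefficient of a path in an element of the path algebra. -/
noncomputable def coeff (x : PathAlgebra k V) (p : QPath V) : k := (basis k V).repr x p

variable (k) in
open Classical in
/-- The product `q * p` of two paths: first `p`, then `q`, and zero if they cannot be composed. -/
noncomputable def pathMul (q p : QPath V) : PathAlgebra k V :=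
  if h : p.tgt = q.src then ofPath k ⟨p.src, q.tgt, (p.path.cast rfl h).comp q.path⟩ else 0

/-- The multiplication of the path algebra, extended bilinearly from paths. -/
noncomputable def mulHom : PathAlgebra k V →ₗ[k] PathAlgebra k V →ₗ[k] PathAlgebra k V :=
  (basis k V).constr k fun q => (basis k V).constr k fun p => pathMul k q p

noncomputable instance : Mul (PathAlgebra k V) := ⟨fun x y => mulHom x y⟩

/-- The unit is the sum of the stationary paths. -/
noncomputable instance [Fintype V] : One (PathAlgebra k V) :=
  ⟨∑ v : V, ofPath k ⟨v, v, Quiver.Path.nil⟩⟩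

lemma mul_def (x y : PathAlgebra k V) : x * y = mulHom x y := rfl

lemma one_def [Fintype V] :
    (1 : PathAlgebra k V) = ∑ v : V, ofPath k ⟨v, v, Quiver.Path.nil⟩ := rfl

lemma hom_ext {N : Type*} [AddCommGroup N] [Module k N] {f g : PathAlgebra k V →ₗ[k] N}
    (h : ∀ p, f (ofPath k p) = g (ofPath k p)) : f = g :=
  (basis k V).ext h

lemma mulHom_ofPath (q p : QPath V) : mulHom (ofPath k q) (ofPath k p) = pathMul k q p := by
  simp [mulHom, ofPath]

lemma pathMul_assoc (r q p : QPath V) :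
    mulHom (pathMul k r q) (ofPath k p) = mulHom (ofPath k r) (pathMul k q p) := by
  obtain ⟨a, b, p⟩ := p
  obtain ⟨c, d, q⟩ := q
  obtain ⟨e, f, r⟩ := r
  by_cases h₁ : b = c
  · by_cases h₂ : d = e
    · subst h₁ h₂
      simp [pathMul, mulHom_ofPath, Quiver.Path.comp_assoc]
    · subst h₁
      simp [pathMul, mulHom_ofPath, h₂]
  · by_cases h₂ : d = e
    · subst h₂
      simp [pathMul, mulHom_ofPath, h₁]
    · simp [pathMul, h₁, h₂]

lemma one_pathMul [Fintype V] (p : QPath V) : mulHom (1 : PathAlgebra k V) (ofPath k p) =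
    ofPath k p := by
  classical
  obtain ⟨a, b, p⟩ := p
  rw [one_def, map_sum, LinearMap.sum_apply, Finset.sum_eq_single b]
  · simp [mulHom_ofPath, pathMul]
  · intro v _ hv
    simp [mulHom_ofPath, pathMul, hv.symm]
  · simp

lemma pathMul_one [Fintype V] (p : QPath V) : mulHom (ofPath k p) (1 : PathAlgebra k V) =
    ofPath k p := by
  classical
  obtain ⟨a, b, p⟩ := p
  rw [one_def, map_sum, Finset.sum_eq_single a]
  · simp [mulHom_ofPath, pathMul]
  · intro v _ hv
    simp [mulHom_ofPath, pathMul, hv]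
  · simp

noncomputable instance [Fintype V] : Ring (PathAlgebra k V) where
  __ := (inferInstance : AddCommGroup (PathAlgebra k V))
  mul := (· * ·)
  one := 1
  left_distrib x y z := map_add (mulHom x) y z
  right_distrib x y z := by simp [mul_def]
  zero_mul x := by simp [mul_def]
  mul_zero x := by simp [mul_def]
  one_mul x := by
    have h : mulHom (1 : PathAlgebra k V) = LinearMap.id := hom_ext fun p => one_pathMul p
    simp [mul_def, h]
  mul_one x := by
    have h : mulHom.flip (1 : PathAlgebra k V) = LinearMap.id := hom_ext fun p => pathMul_one p
    exact LinearMap.congr_fun h x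
  mul_assoc x y z := by
    have key : ∀ x y z : PathAlgebra k V, mulHom (mulHom x y) z = mulHom x (mulHom y z) := by
      intro x y z
      have h₁ : ∀ q p : QPath V,
          mulHom.flip (ofPath k p) ∘ₗ mulHom.flip (ofPath k q) =
            mulHom.flip (mulHom (ofPath k q) (ofPath k p)) := fun q p => hom_ext fun r => by
        simpa [mulHom_ofPath] using pathMul_assoc r q p
      have h₂ : ∀ p : QPath V, mulHom.flip (ofPath k p) ∘ₗ mulHom x =
          mulHom x ∘ₗ mulHom.flip (ofPath k p) := fun p => hom_ext fun q => by
        simpa using LinearMap.congr_fun (h₁ q p) x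
      have h₃ : mulHom (mulHom x y) = mulHom x ∘ₗ mulHom y := hom_ext fun p => by
        simpa using LinearMap.congr_fun (h₂ p) y
      simp [h₃]
    exact key x y z

noncomputable instance [Fintype V] : Algebra k (PathAlgebra k V) :=
  Algebra.ofModule (fun r x y => by simp [mul_def]) (fun r x y => by simp [mul_def])

end PathAlgebra

/-- A (two-sided) ideal `I` of `kQ` is admissible if `J ^ m ⊆ I ⊆ J ^ 2` for some `m ≥ 2`, where
`J` is the ideal generated by the arrows. Here `J ^ m` is spanned by the paths of length at
least `m`. -/
def IsAdmissible [Fintype V] (I : Ideal (PathAlgebra k V)) : Prop :=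
  (∃ m : ℕ, 2 ≤ m ∧ ∀ p : QPath V, m ≤ p.path.length → PathAlgebra.ofPath k p ∈ I) ∧
    ∀ x ∈ I, ∀ p : QPath V, p.path.length < 2 → x.coeff p = 0

end PathAlgebra

/-! ### Bimodules and their tensor products -/

section Bimodules

/-- An `L`-`R`-bimodule over `k` (with `k` acting centrally). The right action of `R` is written as
a left action of the opposite ring. -/
structure Bimodule (k : Type u) [Field k] (L R : Type u) [Ring L] [Algebra k L]
    [Ring R] [Algebra k R] where
  carrier : Type u
  [addCommGroup : AddCommGroup carrier]
  [moduleBase : Module k carrier]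
  [moduleLeft : Module L carrier]
  [moduleRight : Module Rᵐᵒᵖ carrier]
  [towerLeft : IsScalarTower k L carrier]
  [towerRight : IsScalarTower k Rᵐᵒᵖ carrier]
  [comm : SMulCommClass L Rᵐᵒᵖ carrier]

namespace Bimodule

attribute [instance] addCommGroup moduleBase moduleLeft moduleRight towerLeft towerRight comm

variable {k : Type u} [Field k] {L S R : Type u} [Ring L] [Algebra k L] [Ring S] [Algebra k S]
  [Ring R] [Algebra k R]

instance : CoeSort (Bimodule k L R) (Type u) := ⟨carrier⟩

/-- Homomorphisms of bimodules. -/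
structure Hom (M N : Bimodule k L R) extends M →ₗ[L] N where
  map_right : ∀ (r : R) (m : M), toFun (op r • m) = op r • toFun m

/-- The regular bimodule. -/
def regular (k : Type u) [Field k] (R : Type u) [Ring R] [Algebra k R] : Bimodule k R R where
  carrier := R

/-- An `L`-`R`-bimodule as a left module over `L ⊗ Rᵒᵖ`. -/
noncomputable instance envModule (M : Bimodule k L R) : Module (L ⊗[k] Rᵐᵒᵖ) M :=
  TensorProduct.Algebra.module

section Tensor

variable (M : Bimodule k L S) (N : Bimodule k S R)

/-- The relations `m s ⊗ n = m ⊗ s n` that define `M ⊗_S N` as a quotient of `M ⊗_k N`. -/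
def tensorRel : Submodule k (M ⊗[k] N) :=
  Submodule.span k {x | ∃ (m : M) (s : S) (n : N), x = (op s • m) ⊗ₜ[k] n - m ⊗ₜ[k] (s • n)}

/-- The left action on `M ⊗_S N`, through the first factor. -/
noncomputable def tensorLeft : L →+* Module.End k ((M ⊗[k] N) ⧸ tensorRel M N) where
  toFun l := Submodule.mapQ _ _ (TensorProduct.map (Algebra.lsmul k k M l) LinearMap.id) (by
    rw [tensorRel, Submodule.span_le]
    rintro _ ⟨m, s, n, rfl⟩
    refine Submodule.subset_span ⟨l • m, s, n, ?_⟩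
    simp [smul_comm l])
  map_one' := by ext; simp
  map_mul' _ _ := by ext; simp
  map_zero' := by ext; simp
  map_add' _ _ := by ext; simp [TensorProduct.add_tmul]

/-- The right action on `M ⊗_S N`, through the second factor. -/
noncomputable def tensorRight : Rᵐᵒᵖ →+* Module.End k ((M ⊗[k] N) ⧸ tensorRel M N) where
  toFun r := Submodule.mapQ _ _ (TensorProduct.map LinearMap.id (Algebra.lsmul k k N r)) (by
    rw [tensorRel, Submodule.span_le]
    rintro _ ⟨m, s, n, rfl⟩
    refine Submodule.subset_span ⟨m, s, r • n, ?_⟩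
    simp [smul_comm s])
  map_one' := by ext; simp
  map_mul' _ _ := by ext; simp
  map_zero' := by ext; simp
  map_add' _ _ := by ext; simp [TensorProduct.tmul_add]

/-- The tensor product `M ⊗_S N` of an `L`-`S`-bimodule and an `S`-`R`-bimodule. -/
noncomputable def tensor : Bimodule k L R :=
  letI : Module L ((M ⊗[k] N) ⧸ tensorRel M N) := Module.compHom _ (tensorLeft M N)
  letI : Module Rᵐᵒᵖ ((M ⊗[k] N) ⧸ tensorRel M N) := Module.compHom _ (tensorRight M N)
  { carrier := (M ⊗[k] N) ⧸ tensorRel M N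
    towerLeft := ⟨fun c l x => by
      change tensorLeft M N (c • l) x = c • tensorLeft M N l x
      have h : tensorLeft M N (c • l) = c • tensorLeft M N l := by
        ext; simp [tensorLeft, ← TensorProduct.smul_tmul']
      rw [h]; rfl⟩
    towerRight := ⟨fun c r x => by
      change tensorRight M N (c • r) x = c • tensorRight M N r x
      have h : tensorRight M N (c • r) = c • tensorRight M N r := by
        ext; simp [tensorRight]
      rw [h]; rfl⟩
    comm := ⟨fun l r x => by
      change tensorLeft M N l (tensorRight M N r x) = tensorRight M N r (tensorLeft M N l x)
      have h : tensorLeft M N l ∘ₗ tensorRight M N r = tensorRight M N r ∘ₗ tensorLeft M N l := by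
        ext; simp [tensorLeft, tensorRight]
      exact LinearMap.congr_fun h x⟩ }

/-- The class of `m ⊗ n` in `M ⊗_S N`, as a bilinear map. -/
noncomputable def tmul : M →ₗ[k] N →ₗ[k] M.tensor N :=
  (TensorProduct.mk k M N).compr₂ (tensorRel M N).mkQ

variable {M N}

lemma tmul_smul_right (m : M) (s : S) (n : N) : M.tmul N (op s • m) n = M.tmul N m (s • n) :=
  (Submodule.Quotient.eq _).2 (Submodule.subset_span ⟨m, s, n, rfl⟩)

lemma smul_tmul_left (l : L) (m : M) (n : N) : l • M.tmul N m n = M.tmul N (l • m) n := rfl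

lemma smul_tmul_right (r : R) (m : M) (n : N) :
    op r • M.tmul N m n = M.tmul N m (op r • n) := rfl

end Tensor

/-- The tensor powers `M`, `M ⊗ M`, `M ⊗ (M ⊗ M)`, … of a bimodule (and the regular bimodule as
the power of exponent zero). -/
noncomputable def tpow (M : Bimodule k R R) : ℕ → Bimodule k R R
  | 0 => regular k R
  | 1 => M
  | n + 2 => M.tensor (M.tpow (n + 1))

end Bimodule

end Bimodules

/-! ### Relative homological algebra -/

section Relative

open CategoryTheory

variable {k : Type u} [Field k] {R : Type u} [Ring R] [Algebra k R]

/-- Given a subalgebra `S` of `R`, an `R`-module `M` is `(R, S)`-projective if every surjective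
`R`-linear map onto `M` that splits `S`-linearly also splits `R`-linearly. -/
def IsRelProjective (S : Subalgebra k R) (M : Type u) [AddCommGroup M] [Module R M] : Prop :=
  ∀ (N : Type u) [AddCommGroup N] [Module R N] (f : N →ₗ[R] M), Function.Surjective f →
    (∃ g : M →ₗ[S] N, ∀ m, f (g m) = m) → ∃ g : M →ₗ[R] N, ∀ m, f (g m) = m

/-- `HasRelProjDimLE S n M` says that there is an `(R, S)`-exact sequence
`0 → Pₙ → ⋯ → P₁ → P₀ → M → 0` with all the `Pᵢ` being `(R, S)`-projective. The sequence is cut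
at its syzygies: such a sequence of length `n + 1` is a surjection from an `(R, S)`-projective module
onto `M`, with kernel an `S`-module summand, and such a sequence of length `n` for the kernel. -/
def HasRelProjDimLE (S : Subalgebra k R) : ℕ → ModuleCat.{u} R → Prop
  | 0, M => IsRelProjective S M
  | n + 1, M => ∃ (P : ModuleCat.{u} R) (f : P →ₗ[R] M), IsRelProjective S P ∧
      Function.Surjective f ∧
      (∃ C : Submodule S P, IsCompl ((LinearMap.ker f).restrictScalars S) C) ∧
      HasRelProjDimLE S n (ModuleCat.of R (LinearMap.ker f))

end Relative

/-! ### Bounded and strongly proj-bounded extensions -/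

section Extensions

open CategoryTheory

variable {k : Type u} [Field k] {A : Type u} [Ring A] [Algebra k A]

lemma quot_ext (B : Subalgebra k A) {f g : Module.End k (A ⧸ Subalgebra.toSubmodule B)}
    (h : ∀ x : A, f (Submodule.Quotient.mk x) = g (Submodule.Quotient.mk x)) : f = g :=
  LinearMap.ext fun y => Submodule.Quotient.induction_on _ y h

/-- Left multiplication of `B` on `A / B`. -/
noncomputable def quotLeft (B : Subalgebra k A) :
    B →+* Module.End k (A ⧸ Subalgebra.toSubmodule B) where
  toFun b := Submodule.mapQ _ _ (LinearMap.mulLeft k (b : A)) fun _ hx => B.mul_mem b.2 hx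
  map_one' := quot_ext _ fun x => congrArg (Submodule.mkQ _) (one_mul x)
  map_mul' _ _ := quot_ext _ fun x => congrArg (Submodule.mkQ _) (mul_assoc _ _ x)
  map_zero' := quot_ext _ fun x => congrArg (Submodule.mkQ _) (zero_mul x)
  map_add' _ _ := quot_ext _ fun x => congrArg (Submodule.mkQ _) (add_mul _ _ x)

/-- Right multiplication of `B` on `A / B`. -/
noncomputable def quotRight (B : Subalgebra k A) :
    Bᵐᵒᵖ →+* Module.End k (A ⧸ Subalgebra.toSubmodule B) where
  toFun b := Submodule.mapQ _ _ (LinearMap.mulRight k (b.unop : A))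
    fun _ hx => B.mul_mem hx b.unop.2
  map_one' := quot_ext _ fun x => congrArg (Submodule.mkQ _) (mul_one x)
  map_mul' _ _ := quot_ext _ fun x => congrArg (Submodule.mkQ _) (mul_assoc x _ _).symm
  map_zero' := quot_ext _ fun x => congrArg (Submodule.mkQ _) (mul_zero x)
  map_add' _ _ := quot_ext _ fun x => congrArg (Submodule.mkQ _) (mul_add x _ _)

/-- The `B`-bimodule `A / B`. -/
noncomputable def quotBimodule (B : Subalgebra k A) : Bimodule k B B :=
  letI : Module B (A ⧸ Subalgebra.toSubmodule B) := Module.compHom _ (quotLeft B)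
  letI : Module Bᵐᵒᵖ (A ⧸ Subalgebra.toSubmodule B) := Module.compHom _ (quotRight B)
  { carrier := A ⧸ Subalgebra.toSubmodule B
    towerLeft := ⟨fun c b x => by
      change quotLeft B (c • b) x = c • quotLeft B b x
      have h : quotLeft B (c • b) = c • quotLeft B b :=
        quot_ext _ fun x => congrArg (Submodule.mkQ _) (smul_mul_assoc c (b : A) x)
      rw [h]; rfl⟩
    towerRight := ⟨fun c b x => by
      change quotRight B (c • b) x = c • quotRight B b x
      have h : quotRight B (c • b) = c • quotRight B b :=
        quot_ext _ fun x => congrArg (Submodule.mkQ _) (mul_smul_comm c x (b.unop : A))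
      rw [h]; rfl⟩
    comm := ⟨fun b c x => by
      change quotLeft B b (quotRight B c x) = quotRight B c (quotLeft B b x)
      have h : quotLeft B b ∘ₗ quotRight B c = quotRight B c ∘ₗ quotLeft B b :=
        quot_ext _ fun x => congrArg (Submodule.mkQ _) (mul_assoc (b : A) x (c.unop : A)).symm
      exact LinearMap.congr_fun h x⟩ }

/-- The enveloping algebra `Bᵉ = B ⊗ Bᵒᵖ` as a subalgebra of `Aᵉ = A ⊗ Aᵒᵖ`. -/
noncomputable def envSubalgebra (B : Subalgebra k A) : Subalgebra k (A ⊗[k] Aᵐᵒᵖ) :=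
  (Algebra.TensorProduct.map B.val (AlgHom.op B.val)).range

/-- The bimodule `A / B` has finite projective dimension over the enveloping algebra of `B`. -/
def QuotHasFiniteProjDim (B : Subalgebra k A) : Prop :=
  ∃ n : ℕ, HasProjectiveDimensionLE (ModuleCat.of (B ⊗[k] Bᵐᵒᵖ) (quotBimodule B)) n

/-- `A / B` is projective as a left or as a right `B`-module. -/
def QuotOneSidedProjective (B : Subalgebra k A) : Prop :=
  Module.Projective B (quotBimodule B) ∨ Module.Projective Bᵐᵒᵖ (quotBimodule B)

/-- Bounded extensions `B ⊆ A`. -/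
structure IsBounded (B : Subalgebra k A) : Prop where
  finite_projDim : QuotHasFiniteProjDim B
  oneSided : QuotOneSidedProjective B
  nilpotent : ∃ p : ℕ, 1 ≤ p ∧ Subsingleton ((quotBimodule B).tpow p)

/-- Proj-bounded extensions `B ⊆ A`. -/
structure IsProjBounded (B : Subalgebra k A) : Prop where
  finite_projDim : QuotHasFiniteProjDim B
  oneSided : QuotOneSidedProjective B
  tpow_projective : ∃ p : ℕ, 1 ≤ p ∧ ∀ n : ℕ, p ≤ n →
    Module.Projective (B ⊗[k] Bᵐᵒᵖ) ((quotBimodule B).tpow n)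

/-- Strongly proj-bounded extensions `B ⊆ A`: moreover `A` has finite relative projective dimension
with respect to the extension `Bᵉ ⊆ Aᵉ`. -/
structure IsStronglyProjBounded (B : Subalgebra k A) : Prop extends IsProjBounded B where
  finite_relProjDim : ∃ n : ℕ,
    HasRelProjDimLE (envSubalgebra B) n (ModuleCat.of (A ⊗[k] Aᵐᵒᵖ) (Bimodule.regular k A))

end Extensions

/-! ### The triangular matrix algebra -/

section Triangular

variable {k : Type u} [Field k] {A₂ B A₁ : Type u} [Ring A₂] [Algebra k A₂] [Ring B] [Algebra k B]
  [Ring A₁] [Algebra k A₁] {M₂ : Bimodule k A₂ B} {M₁ : Bimodule k B A₁} {M₂₁ : Bimodule k A₂ A₁}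

/-- The matrices
```
a₂  m₂  m₂₁
0   b   m₁
0   0   a₁
``` -/
@[ext]
structure TriMatrix (ρ : (M₂.tensor M₁).Hom M₂₁) where
  a₂ : A₂
  m₂ : M₂
  m₂₁ : M₂₁
  b : B
  m₁ : M₁
  a₁ : A₁

namespace TriMatrix

variable (ρ : (M₂.tensor M₁).Hom M₂₁)

/-- The product of `M₂` and `M₁` with values in `M₂₁` that is induced by `ρ`. -/
noncomputable def pair (x : M₂) (y : M₁) : M₂₁ := ρ.toLinearMap (M₂.tmul M₁ x y)

section pair

variable (x x' : M₂) (y y' : M₁) (a₂ : A₂) (b : B) (a₁ : A₁) (c : k)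

lemma pair_add_left : pair ρ (x + x') y = pair ρ x y + pair ρ x' y := by simp [pair]

lemma pair_add_right : pair ρ x (y + y') = pair ρ x y + pair ρ x y' := by simp [pair]

lemma pair_zero_left : pair ρ 0 y = 0 := by simp [pair]

lemma pair_zero_right : pair ρ x 0 = 0 := by simp [pair]

lemma pair_smul_left : pair ρ (a₂ • x) y = a₂ • pair ρ x y := by
  rw [pair, ← Bimodule.smul_tmul_left, map_smul, pair]

lemma pair_smul_right : pair ρ x (op a₁ • y) = op a₁ • pair ρ x y := by
  rw [pair, ← Bimodule.smul_tmul_right]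
  exact ρ.map_right a₁ _

lemma pair_balanced : pair ρ (op b • x) y = pair ρ x (b • y) := by
  rw [pair, Bimodule.tmul_smul_right, pair]

lemma pair_base_left : pair ρ (c • x) y = c • pair ρ x y := by
  rw [← algebraMap_smul A₂ c x, pair_smul_left, algebraMap_smul]

lemma pair_base_right : pair ρ x (c • y) = c • pair ρ x y := by
  rw [← algebraMap_smul A₁ᵐᵒᵖ c y, ← algebraMap_smul A₁ᵐᵒᵖ c (pair ρ x y)]
  exact pair_smul_right ρ x y (algebraMap k A₁ c)

end pair

variable {ρ}

instance : Zero (TriMatrix ρ) := ⟨⟨0, 0, 0, 0, 0, 0⟩⟩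

instance : One (TriMatrix ρ) := ⟨⟨1, 0, 0, 1, 0, 1⟩⟩

instance : Add (TriMatrix ρ) :=
  ⟨fun x y => ⟨x.a₂ + y.a₂, x.m₂ + y.m₂, x.m₂₁ + y.m₂₁, x.b + y.b, x.m₁ + y.m₁, x.a₁ + y.a₁⟩⟩

instance : Neg (TriMatrix ρ) := ⟨fun x => ⟨-x.a₂, -x.m₂, -x.m₂₁, -x.b, -x.m₁, -x.a₁⟩⟩

instance : SMul k (TriMatrix ρ) :=
  ⟨fun c x => ⟨c • x.a₂, c • x.m₂, c • x.m₂₁, c • x.b, c • x.m₁, c • x.a₁⟩⟩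

/-- Matrix multiplication. -/
noncomputable instance : Mul (TriMatrix ρ) :=
  ⟨fun x y =>
    { a₂ := x.a₂ * y.a₂
      m₂ := x.a₂ • y.m₂ + op y.b • x.m₂
      m₂₁ := x.a₂ • y.m₂₁ + pair ρ x.m₂ y.m₁ + op y.a₁ • x.m₂₁
      b := x.b * y.b
      m₁ := x.b • y.m₁ + op y.a₁ • x.m₁
      a₁ := x.a₁ * y.a₁ }⟩

@[simp] lemma zero_a₂ : (0 : TriMatrix ρ).a₂ = 0 := rfl
@[simp] lemma zero_m₂ : (0 : TriMatrix ρ).m₂ = 0 := rfl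
@[simp] lemma zero_m₂₁ : (0 : TriMatrix ρ).m₂₁ = 0 := rfl
@[simp] lemma zero_b : (0 : TriMatrix ρ).b = 0 := rfl
@[simp] lemma zero_m₁ : (0 : TriMatrix ρ).m₁ = 0 := rfl
@[simp] lemma zero_a₁ : (0 : TriMatrix ρ).a₁ = 0 := rfl
@[simp] lemma one_a₂ : (1 : TriMatrix ρ).a₂ = 1 := rfl
@[simp] lemma one_m₂ : (1 : TriMatrix ρ).m₂ = 0 := rfl
@[simp] lemma one_m₂₁ : (1 : TriMatrix ρ).m₂₁ = 0 := rfl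
@[simp] lemma one_b : (1 : TriMatrix ρ).b = 1 := rfl
@[simp] lemma one_m₁ : (1 : TriMatrix ρ).m₁ = 0 := rfl
@[simp] lemma one_a₁ : (1 : TriMatrix ρ).a₁ = 1 := rfl

section apply

variable (x y : TriMatrix ρ) (c : k)

@[simp] lemma add_a₂ : (x + y).a₂ = x.a₂ + y.a₂ := rfl
@[simp] lemma add_m₂ : (x + y).m₂ = x.m₂ + y.m₂ := rfl
@[simp] lemma add_m₂₁ : (x + y).m₂₁ = x.m₂₁ + y.m₂₁ := rfl
@[simp] lemma add_b : (x + y).b = x.b + y.b := rfl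
@[simp] lemma add_m₁ : (x + y).m₁ = x.m₁ + y.m₁ := rfl
@[simp] lemma add_a₁ : (x + y).a₁ = x.a₁ + y.a₁ := rfl
@[simp] lemma neg_a₂ : (-x).a₂ = -x.a₂ := rfl
@[simp] lemma neg_m₂ : (-x).m₂ = -x.m₂ := rfl
@[simp] lemma neg_m₂₁ : (-x).m₂₁ = -x.m₂₁ := rfl
@[simp] lemma neg_b : (-x).b = -x.b := rfl
@[simp] lemma neg_m₁ : (-x).m₁ = -x.m₁ := rfl
@[simp] lemma neg_a₁ : (-x).a₁ = -x.a₁ := rfl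
@[simp] lemma smul_a₂ : (c • x).a₂ = c • x.a₂ := rfl
@[simp] lemma smul_m₂ : (c • x).m₂ = c • x.m₂ := rfl
@[simp] lemma smul_m₂₁ : (c • x).m₂₁ = c • x.m₂₁ := rfl
@[simp] lemma smul_b : (c • x).b = c • x.b := rfl
@[simp] lemma smul_m₁ : (c • x).m₁ = c • x.m₁ := rfl
@[simp] lemma smul_a₁ : (c • x).a₁ = c • x.a₁ := rfl
@[simp] lemma mul_a₂ : (x * y).a₂ = x.a₂ * y.a₂ := rfl
@[simp] lemma mul_m₂ : (x * y).m₂ = x.a₂ • y.m₂ + op y.b • x.m₂ := rfl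
@[simp] lemma mul_m₂₁ :
    (x * y).m₂₁ = x.a₂ • y.m₂₁ + pair ρ x.m₂ y.m₁ + op y.a₁ • x.m₂₁ := rfl
@[simp] lemma mul_b : (x * y).b = x.b * y.b := rfl
@[simp] lemma mul_m₁ : (x * y).m₁ = x.b • y.m₁ + op y.a₁ • x.m₁ := rfl
@[simp] lemma mul_a₁ : (x * y).a₁ = x.a₁ * y.a₁ := rfl

end apply

instance : AddCommGroup (TriMatrix ρ) where
  add_assoc x y z := by ext <;> simp [add_assoc]
  zero_add x := by ext <;> simp
  add_zero x := by ext <;> simp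
  add_comm x y := by ext <;> simp [add_comm]
  neg_add_cancel x := by ext <;> simp
  nsmul := nsmulRec
  zsmul := zsmulRec

instance : Module k (TriMatrix ρ) where
  one_smul x := by ext <;> simp
  mul_smul c d x := by ext <;> simp [mul_smul]
  smul_zero c := by ext <;> simp
  smul_add c x y := by ext <;> simp
  add_smul c d x := by ext <;> simp [add_smul]
  zero_smul x := by ext <;> simp

noncomputable instance : Ring (TriMatrix ρ) where
  __ := (inferInstance : AddCommGroup (TriMatrix ρ))
  mul := (· * ·)
  one := 1
  left_distrib x y z := by
    ext <;> simp [mul_add, add_smul, pair_add_right] <;> abel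
  right_distrib x y z := by
    ext <;> simp [add_mul, add_smul, pair_add_left] <;> abel
  zero_mul x := by ext <;> simp [pair_zero_left]
  mul_zero x := by ext <;> simp [pair_zero_right]
  one_mul x := by ext <;> simp [pair_zero_left]
  mul_one x := by ext <;> simp [pair_zero_right]
  mul_assoc x y z := by
    ext <;> simp [mul_assoc, mul_smul, pair_add_left, pair_add_right, pair_smul_left,
      pair_smul_right, pair_balanced, smul_comm x.a₂ (op z.b), smul_comm x.a₂ (op z.a₁),
      smul_comm x.b (op z.a₁)] <;> abel

noncomputable instance : Algebra k (TriMatrix ρ) :=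
  Algebra.ofModule
    (fun c x y => by
      ext <;> simp [pair_base_left, smul_comm _ c])
    (fun c x y => by
      ext <;> simp [pair_base_right, smul_comm _ c])

variable (ρ) in
/-- The subalgebra of the matrices `diag(c, b, c)` with `b` in the middle algebra and `c` a scalar.
This is the product of the middle algebra and `k E`, where `E = diag(1, 0, 1)`. -/
def subalgebra : Subalgebra k (TriMatrix ρ) where
  carrier := {x | x.m₂ = 0 ∧ x.m₂₁ = 0 ∧ x.m₁ = 0 ∧
    ∃ c : k, x.a₂ = algebraMap k A₂ c ∧ x.a₁ = algebraMap k A₁ c}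
  mul_mem' := by
    rintro x y ⟨h₁, h₂, h₃, c, h₄, h₅⟩ ⟨g₁, g₂, g₃, d, g₄, g₅⟩
    refine ⟨by simp [h₁, g₁], by simp [h₂, g₂, h₁, pair_zero_left], by simp [h₃, g₃], c * d, ?_, ?_⟩
    · simp [h₄, g₄]
    · simp [h₅, g₅]
  add_mem' := by
    rintro x y ⟨h₁, h₂, h₃, c, h₄, h₅⟩ ⟨g₁, g₂, g₃, d, g₄, g₅⟩
    exact ⟨by simp [h₁, g₁], by simp [h₂, g₂], by simp [h₃, g₃], c + d, by simp [h₄, g₄],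
      by simp [h₅, g₅]⟩
  algebraMap_mem' c := by
    rw [Algebra.algebraMap_eq_smul_one]
    exact ⟨by simp, by simp, by simp, c, by simp [Algebra.algebraMap_eq_smul_one],
      by simp [Algebra.algebraMap_eq_smul_one]⟩

end TriMatrix

end Triangular

end ProjBounded

/-! The first three conditions follow from one stronger fact: `A/B` is a projective `B^e`-module.
Modulo `B` the matrix entries split into `M₁`, `M₂` and the outer part `EAE/kE`. On the outer side
`B` acts only through scalars, so `M₁` is projective over `B^e` because it is projective over the
left factor, `M₂` because it is projective over the right factor, and the outer part because it is a
vector space placed at `E ⊗ E`. Each projection is factored through a free `B^e`-module, and the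
three factorizations together split `A/B` off a free module (`projective_quotBimodule`). Hence its
projective dimension is zero. Projective bimodules are projective on the right, and the tensor-hom
adjunction shows that tensoring preserves projectivity, so `p = 1` works for the tensor powers.

For the relative dimension, the vertices of `X₂`, the unit of the middle algebra and the vertices of
`X₁` give a finite family of orthogonal idempotents commuting with `B`. It makes `A` upper
triangular with diagonal blocks `e B`, and its tensor squares do the same for `A^e` over `B^e`. For
`B^e` and these idempotents inside `A^e`, let `S'` be the subring generated by them. The induced
module `A^e ⊗_{S'} N` is relatively projective, and the kernel of its action map onto `N` is killed
by one more level of idempotents than `N` is. After finitely many steps the syzygy is zero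
(`hasRelProjDimLE_of_level`).

Boundedness fails because the coefficients at two different vertices of `X₁` and `X₂` agree on `B`.
Their difference is a nonzero functional on `A/B` on which both sides of `B` act through the same
character, and its tensor powers are nonzero functionals on the tensor powers of `A/B`. -/

namespace ProjBounded

/-! ### Relative resolutions from triangular idempotents -/

section TriangularIdempotents

variable {k : Type u} [Field k] {R : Type u} [Ring R] [Algebra k R]

/-- A complete family of orthogonal idempotents of `R`, commuting with the subalgebra `S`, for which
`R` is upper triangular with diagonal blocks `e i * S`. -/
structure TriangularIdempotents (S : Subalgebra k R) (ι : Type*) [Fintype ι] where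
  e : ι → R
  level : ι → ℕ
  sum_e : ∑ i, e i = 1
  e_mul_self : ∀ i, e i * e i = e i
  e_mul_of_ne : ∀ i j, i ≠ j → e i * e j = 0
  comm : ∀ i, ∀ s ∈ S, e i * s = s * e i
  triangular : ∀ i j, i ≠ j → level j ≤ level i → ∀ r, e i * r * e j = 0
  diagonal : ∀ i r, ∃ s ∈ S, e i * r * e i = e i * s

namespace TriangularIdempotents

variable {S : Subalgebra k R} {ι : Type*} [Fintype ι] (T : TriangularIdempotents S ι)
variable (N : Type u) [AddCommGroup N] [Module R N]

/-- The relations `r e i s ⊗ n = r ⊗ e i s n`. -/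
def coverRel : Submodule R (R ⊗[ℤ] N) :=
  Submodule.span R {x | ∃ (i : ι) (s : R) (n : N), s ∈ S ∧
    x = (T.e i * s) ⊗ₜ[ℤ] n - (1 : R) ⊗ₜ[ℤ] ((T.e i * s) • n)}

/-- The tensor product of `R` and `N` over the subring generated by `S` and the idempotents. -/
abbrev Cover : Type u := (R ⊗[ℤ] N) ⧸ T.coverRel N

variable {N}

/-- The class of `1 ⊗ n`. -/
def coverOne (n : N) : T.Cover N := Submodule.Quotient.mk ((1 : R) ⊗ₜ[ℤ] n)

lemma coverOne_add (m n : N) : T.coverOne (m + n) = T.coverOne m + T.coverOne n := by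
  simp [coverOne, TensorProduct.tmul_add]

lemma coverOne_zero : T.coverOne (0 : N) = 0 := by
  simp [coverOne]

lemma mk_tmul (r : R) (n : N) :
    (Submodule.Quotient.mk (r ⊗ₜ[ℤ] n) : T.Cover N) = r • T.coverOne n := by
  rw [coverOne, ← Submodule.Quotient.mk_smul, TensorProduct.smul_tmul', smul_eq_mul, mul_one]

lemma cover_induction {p : T.Cover N → Prop} (h : ∀ (r : R) (n : N), p (r • T.coverOne n))
    (hadd : ∀ x y, p x → p y → p (x + y)) (x : T.Cover N) : p x := by
  induction x using Submodule.Quotient.induction_on with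
  | _ x =>
    induction x with
    | zero => simpa using h 0 0
    | tmul r n => rw [mk_tmul]; exact h r n
    | add x y hx hy => rw [Submodule.Quotient.mk_add]; exact hadd _ _ hx hy

lemma e_mul_smul_coverOne (i : ι) {s : R} (hs : s ∈ S) (n : N) :
    (T.e i * s) • T.coverOne n = T.coverOne ((T.e i * s) • n) := by
  rw [← mk_tmul]
  exact (Submodule.Quotient.eq _).2 (Submodule.subset_span ⟨i, s, n, hs, rfl⟩)

lemma e_smul_coverOne (i : ι) (n : N) : T.e i • T.coverOne n = T.coverOne (T.e i • n) := by
  simpa using T.e_mul_smul_coverOne i S.one_mem n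

lemma sum_e_smul {M : Type*} [AddCommGroup M] [Module R M] (m : M) : ∑ i, T.e i • m = m := by
  rw [← Finset.sum_smul, T.sum_e, one_smul]

lemma coverOne_sum {κ : Type*} (t : Finset κ) (f : κ → N) :
    T.coverOne (∑ i ∈ t, f i) = ∑ i ∈ t, T.coverOne (f i) :=
  map_sum (⟨⟨T.coverOne, T.coverOne_zero⟩, T.coverOne_add⟩ : N →+ T.Cover N) f t

/-- Since `s` is the sum of the `e i * s`, it crosses the tensor sign summand by summand. This makes
`coverOne` an `S`-linear section of the action map. -/
lemma smul_coverOne {s : R} (hs : s ∈ S) (n : N) : s • T.coverOne n = T.coverOne (s • n) := by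
  rw [← T.sum_e_smul (s • T.coverOne n), ← T.sum_e_smul (s • n), coverOne_sum]
  refine Finset.sum_congr rfl fun i _ => ?_
  rw [smul_smul, smul_smul, T.e_mul_smul_coverOne i hs]

/-- The universal property of the cover. -/
def coverLift {M : Type*} [AddCommGroup M] [Module R M] (φ : N →+ M)
    (h : ∀ (i : ι) (s : R) (n : N), s ∈ S → (T.e i * s) • φ n = φ ((T.e i * s) • n)) :
    T.Cover N →ₗ[R] M :=
  (T.coverRel N).liftQ
    (TensorProduct.AlgebraTensorModule.lift
      (LinearMap.toSpanSingleton R (N →ₗ[ℤ] M) φ.toIntLinearMap)) (by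
    rw [coverRel, Submodule.span_le]
    rintro _ ⟨i, s, n, hs, rfl⟩
    simp [h i s n hs])

@[simp]
lemma coverLift_coverOne {M : Type*} [AddCommGroup M] [Module R M] (φ : N →+ M)
    (h : ∀ (i : ι) (s : R) (n : N), s ∈ S → (T.e i * s) • φ n = φ ((T.e i * s) • n)) (n : N) :
    T.coverLift φ h (T.coverOne n) = φ n := by
  simp [coverLift, coverOne]

/-- The subring spanned by the `e i * s` is separable over `S`: an `S`-linear section can be
averaged with the idempotents until it commutes with them, and a map linear over that subring
extends to the induced module. -/
lemma isRelProjective_cover : IsRelProjective S (T.Cover N) := by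
  classical
  rintro M _ _ f - ⟨g, hg⟩
  -- Cutting `g` by the same idempotent on both sides and summing makes it commute with every `e i`,
  -- without losing compatibility with `S`.
  let φ : N →+ M :=
    { toFun n := ∑ i, T.e i • g (T.coverOne (T.e i • n))
      map_zero' := by simp [coverOne_zero]
      map_add' m n := by simp [coverOne_add, Finset.sum_add_distrib] }
  have hgs : ∀ s ∈ S, ∀ x, g (s • x) = s • g x := fun s hs x => g.map_smul ⟨s, hs⟩ x
  have hφ : ∀ (i : ι) (s : R) (n : N), s ∈ S → (T.e i * s) • φ n = φ ((T.e i * s) • n) := by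
    intro i s n hs
    change (T.e i * s) • ∑ j, T.e j • g (T.coverOne (T.e j • n)) =
      ∑ j, T.e j • g (T.coverOne (T.e j • (T.e i * s) • n))
    rw [Finset.smul_sum, Finset.sum_eq_single i, Finset.sum_eq_single i]
    · rw [smul_smul, mul_assoc, ← T.comm i s hs, ← mul_assoc, T.e_mul_self, smul_smul,
        ← mul_assoc, T.e_mul_self, T.comm i s hs, mul_smul s, mul_smul s, ← T.smul_coverOne hs,
        hgs s hs, smul_smul, smul_smul, T.comm i s hs]
    · intro j _ hj
      rw [smul_smul, ← mul_assoc, T.e_mul_of_ne j i hj, zero_mul, zero_smul, coverOne_zero,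
        map_zero, smul_zero]
    · simp
    · intro j _ hj
      rw [smul_smul, mul_assoc, ← T.comm j s hs, ← mul_assoc, T.e_mul_of_ne i j hj.symm, zero_mul,
        zero_smul]
    · simp
  refine ⟨T.coverLift φ hφ, fun x => ?_⟩
  induction x using T.cover_induction with
  | h r n =>
    have : f (φ n) = T.coverOne n := by
      change f (∑ i, T.e i • g (T.coverOne (T.e i • n))) = _
      rw [map_sum, ← T.sum_e_smul (T.coverOne n)]
      refine Finset.sum_congr rfl fun i _ => ?_
      rw [map_smul, hg, ← e_smul_coverOne, smul_smul, T.e_mul_self]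
    rw [map_smul, map_smul, coverLift_coverOne, this]
  | hadd x y hx hy => rw [map_add, map_add, hx, hy]

variable (N) in
/-- The action map of the cover. -/
def coverMap : T.Cover N →ₗ[R] N := T.coverLift (AddMonoidHom.id N) fun _ _ _ _ => rfl

@[simp]
lemma coverMap_coverOne (n : N) : T.coverMap N (T.coverOne n) = n := by
  simp [coverMap]

/-- Expand `e i • (r ⊗ n)` as the sum of `e i * r * e j ⊗ e j • n`. For `j ≠ i` the left factor
vanishes if `level j ≤ level i`, and otherwise `level j ≥ m + 1` and the right factor vanishes. The
term `j = i` lies in the diagonal block `e i * S`, which crosses the tensor sign. -/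
lemma exists_e_smul_eq_coverOne {m : ℕ} (hN : ∀ i, m + 1 ≤ T.level i → ∀ n : N, T.e i • n = 0)
    {i : ι} (hi : m ≤ T.level i) (x : T.Cover N) : ∃ n, T.e i • x = T.coverOne n := by
  induction x using T.cover_induction with
  | h r n =>
    obtain ⟨s, hs, hsr⟩ := T.diagonal i r
    refine ⟨(T.e i * s) • n, ?_⟩
    have h₁ : T.e i • r • T.coverOne n =
        ∑ j, (T.e i * r * T.e j) • T.coverOne (T.e j • n) := by
      rw [← T.sum_e_smul n, coverOne_sum, Finset.smul_sum, Finset.smul_sum]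
      refine Finset.sum_congr rfl fun j _ => ?_
      rw [T.sum_e_smul n, ← e_smul_coverOne, smul_smul, smul_smul, smul_smul, mul_assoc _ (T.e j),
        T.e_mul_self]
    rw [h₁, Finset.sum_eq_single i, hsr, T.e_mul_smul_coverOne i hs, smul_smul, mul_assoc,
      ← T.comm i s hs, ← mul_assoc, T.e_mul_self]
    · intro j _ hj
      by_cases hl : T.level j ≤ T.level i
      · rw [T.triangular i j hj.symm hl, zero_smul]
      · rw [hN j (by lia), coverOne_zero, smul_zero]
    · simp
  | hadd x y hx hy =>
    obtain ⟨a, ha⟩ := hx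
    obtain ⟨b, hb⟩ := hy
    exact ⟨a + b, by rw [smul_add, ha, hb, coverOne_add]⟩

/-- Each cover improves the bound by one level: for `level i ≥ m`, an element `e i • x` of the
kernel has the form `1 ⊗ n`, and the action map sends it to `n`, so `n = 0`. At `m = 0` all
idempotents kill the module, which is therefore zero. -/
lemma hasRelProjDimLE_of_level (m : ℕ) (N : ModuleCat.{u} R)
    (hN : ∀ i, m ≤ T.level i → ∀ n : N, T.e i • n = 0) : HasRelProjDimLE S m N := by
  induction m generalizing N with
  | zero =>
    have h0 (n : N) : n = 0 := by
      rw [← T.sum_e_smul n]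
      exact Finset.sum_eq_zero fun i _ => hN i (Nat.zero_le _) n
    intro M _ _ f _ _
    exact ⟨0, fun n => (h0 _).trans (h0 n).symm⟩
  | succ m ih =>
    refine ⟨ModuleCat.of R (T.Cover N), T.coverMap N, T.isRelProjective_cover,
      fun n => ⟨T.coverOne n, T.coverMap_coverOne n⟩, ?_, ?_⟩
    · let σ : N →ₗ[S] T.Cover N :=
        { toFun := T.coverOne
          map_add' := T.coverOne_add
          map_smul' s n := (T.smul_coverOne s.2 n).symm }
      refine ⟨LinearMap.range σ, Submodule.disjoint_def.2 ?_,
        Submodule.codisjoint_iff_exists_add_eq.2 fun x => ?_⟩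
      · rintro _ hx ⟨n, rfl⟩
        have hn : T.coverMap N (T.coverOne n) = 0 := hx
        rw [coverMap_coverOne] at hn
        rw [hn, map_zero]
      · refine ⟨x - T.coverOne (T.coverMap N x), T.coverOne (T.coverMap N x), ?_, ⟨_, rfl⟩,
          sub_add_cancel _ _⟩
        change T.coverMap N _ = 0
        rw [map_sub, coverMap_coverOne, sub_self]
    · refine ih _ fun i hi x => Subtype.ext ?_
      obtain ⟨n, hn⟩ := T.exists_e_smul_eq_coverOne hN hi x.1
      have h₁ : T.coverMap N (T.e i • x.1) = 0 := by
        rw [map_smul, LinearMap.mem_ker.1 x.2, smul_zero]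
      rw [hn, coverMap_coverOne] at h₁
      change T.e i • x.1 = 0
      rw [hn, h₁, coverOne_zero]

theorem exists_hasRelProjDimLE (T : TriangularIdempotents S ι) (N : ModuleCat.{u} R) :
    ∃ n, HasRelProjDimLE S n N :=
  ⟨Finset.univ.sup T.level + 1, T.hasRelProjDimLE_of_level _ N fun i hi => by
    have := Finset.le_sup (f := T.level) (Finset.mem_univ i)
    lia⟩

end TriangularIdempotents

end TriangularIdempotents

/-! ### Triangular idempotents in the enveloping algebra -/

section EnvelopingIdempotents

variable {k : Type u} [Field k] {A : Type u} [Ring A] [Algebra k A]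

lemma tmul_mem_envSubalgebra {B : Subalgebra k A} {b c : A} (hb : b ∈ B) (hc : c ∈ B) :
    b ⊗ₜ[k] op c ∈ envSubalgebra B :=
  ⟨(⟨b, hb⟩ : B) ⊗ₜ[k] op (⟨c, hc⟩ : B), by simp⟩

lemma envSubalgebra_induction {B : Subalgebra k A} {p : A ⊗[k] Aᵐᵒᵖ → Prop} (h0 : p 0)
    (h : ∀ b ∈ B, ∀ c ∈ B, p (b ⊗ₜ[k] op c)) (hadd : ∀ x y, p x → p y → p (x + y))
    {x : A ⊗[k] Aᵐᵒᵖ} (hx : x ∈ envSubalgebra B) : p x := by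
  obtain ⟨y, rfl⟩ := hx
  induction y with
  | zero => simpa using h0
  | tmul b c => simpa using h _ b.2 _ c.unop.2
  | add x y hx hy => rw [map_add]; exact hadd _ _ hx hy

/-- The tensor products of triangular idempotents are triangular in the enveloping algebra. -/
noncomputable def TriangularIdempotents.env {B : Subalgebra k A} {ι : Type*} [Fintype ι]
    (T : TriangularIdempotents B ι) : TriangularIdempotents (envSubalgebra B) (ι × ι) where
  e i := T.e i.1 ⊗ₜ[k] op (T.e i.2)
  -- Passing to the opposite algebra reverses the order; subtracting from the maximum keeps the
  -- level a natural number.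
  level i := T.level i.1 + (Finset.univ.sup T.level - T.level i.2)
  sum_e := by
    rw [Fintype.sum_prod_type]
    have h : ∑ i, op (T.e i) = 1 := by
      rw [← MulOpposite.op_one, ← T.sum_e]
      exact (map_sum MulOpposite.opAddEquiv T.e Finset.univ).symm
    simp only [← TensorProduct.tmul_sum, h]
    rw [← TensorProduct.sum_tmul, T.sum_e]
    rfl
  e_mul_self i := by
    rw [Algebra.TensorProduct.tmul_mul_tmul, ← MulOpposite.op_mul, T.e_mul_self, T.e_mul_self]
  e_mul_of_ne i j hij := by
    rw [Algebra.TensorProduct.tmul_mul_tmul, ← MulOpposite.op_mul]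
    by_cases h : i.1 = j.1
    · rw [T.e_mul_of_ne j.2 i.2 fun h' => hij (Prod.ext h h'.symm), MulOpposite.op_zero,
        TensorProduct.tmul_zero]
    · rw [T.e_mul_of_ne _ _ h, TensorProduct.zero_tmul]
  comm i s hs := by
    refine envSubalgebra_induction
      (p := fun s => T.e i.1 ⊗ₜ[k] op (T.e i.2) * s = s * T.e i.1 ⊗ₜ[k] op (T.e i.2))
      (by simp) (fun b hb c hc => ?_) (fun x y hx hy => by rw [mul_add, add_mul, hx, hy]) hs
    rw [Algebra.TensorProduct.tmul_mul_tmul, Algebra.TensorProduct.tmul_mul_tmul,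
      ← MulOpposite.op_mul, ← MulOpposite.op_mul, T.comm _ b hb, T.comm _ c hc]
  triangular i j hij hl r := by
    induction r with
    | zero => simp
    | tmul a c =>
      obtain ⟨c, rfl⟩ := MulOpposite.op_surjective c
      rw [Algebra.TensorProduct.tmul_mul_tmul, Algebra.TensorProduct.tmul_mul_tmul,
        ← MulOpposite.op_mul, ← MulOpposite.op_mul, ← mul_assoc]
      -- If the product is nonzero, each tensor factor is either diagonal or strictly raises its
      -- contribution to the level. So the pair is diagonal or its level goes up, and both are
      -- excluded.
      by_contra hne
      have h₁ : i.1 = j.1 ∨ T.level i.1 < T.level j.1 := by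
        by_contra! h
        exact hne (by rw [T.triangular _ _ h.1 h.2, TensorProduct.zero_tmul])
      have h₂ : j.2 = i.2 ∨ T.level j.2 < T.level i.2 := by
        by_contra! h
        exact hne (by rw [T.triangular _ _ h.1 h.2, MulOpposite.op_zero, TensorProduct.tmul_zero])
      have h₃ := Finset.le_sup (f := T.level) (Finset.mem_univ i.2)
      have h₄ := Finset.le_sup (f := T.level) (Finset.mem_univ j.2)
      rcases h₁ with h₁ | h₁ <;> rcases h₂ with h₂ | h₂
      · exact hij (Prod.ext h₁ h₂.symm)
      · rw [h₁] at hl; lia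
      · rw [h₂] at hl; lia
      · lia
    | add x y hx hy => rw [mul_add, add_mul, hx, hy, add_zero]
  diagonal i r := by
    induction r with
    | zero => exact ⟨0, zero_mem _, by simp⟩
    | tmul a c =>
      obtain ⟨c, rfl⟩ := MulOpposite.op_surjective c
      obtain ⟨s, hs, hs'⟩ := T.diagonal i.1 a
      obtain ⟨t, ht, ht'⟩ := T.diagonal i.2 c
      refine ⟨s ⊗ₜ[k] op t, tmul_mem_envSubalgebra hs ht, ?_⟩
      rw [Algebra.TensorProduct.tmul_mul_tmul, Algebra.TensorProduct.tmul_mul_tmul,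
        Algebra.TensorProduct.tmul_mul_tmul, ← MulOpposite.op_mul, ← MulOpposite.op_mul,
        ← MulOpposite.op_mul, ← mul_assoc, hs', ht', T.comm _ t ht]
    | add x y hx hy =>
      obtain ⟨s, hs, hs'⟩ := hx
      obtain ⟨t, ht, ht'⟩ := hy
      exact ⟨s + t, add_mem hs ht, by rw [mul_add, add_mul, hs', ht', mul_add]⟩

end EnvelopingIdempotents

/-! ### Triangular idempotents of the matrix algebra -/

section TriMatrixIdempotents

variable {k : Type u} [Field k] {A₂ B A₁ : Type u} [Ring A₂] [Algebra k A₂] [Ring B] [Algebra k B]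
  [Ring A₁] [Algebra k A₁] {M₂ : Bimodule k A₂ B} {M₁ : Bimodule k B A₁} {M₂₁ : Bimodule k A₂ A₁}

namespace TriMatrix

/-- A sum of matrices in the upper left corner. -/
lemma sum_diag_a₂ (ρ : (M₂.tensor M₁).Hom M₂₁) {ι : Type*} (t : Finset ι) (f : ι → A₂) :
    ∑ i ∈ t, (⟨f i, 0, 0, 0, 0, 0⟩ : TriMatrix ρ) = ⟨∑ i ∈ t, f i, 0, 0, 0, 0, 0⟩ :=
  (map_sum (⟨⟨fun a => (⟨a, 0, 0, 0, 0, 0⟩ : TriMatrix ρ), rfl⟩,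
    fun x y => by ext <;> simp⟩ : A₂ →+ TriMatrix ρ) f t).symm

lemma sum_diag_a₁ (ρ : (M₂.tensor M₁).Hom M₂₁) {ι : Type*} (t : Finset ι) (f : ι → A₁) :
    ∑ i ∈ t, (⟨0, 0, 0, 0, 0, f i⟩ : TriMatrix ρ) = ⟨0, 0, 0, 0, 0, ∑ i ∈ t, f i⟩ :=
  (map_sum (⟨⟨fun a => (⟨0, 0, 0, 0, 0, a⟩ : TriMatrix ρ), rfl⟩,
    fun x y => by ext <;> simp⟩ : A₁ →+ TriMatrix ρ) f t).symm

/-- Triangular idempotents of the outer diagonal algebras give triangular idempotents of the matrix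
algebra. -/
noncomputable def triangularIdempotents (ρ : (M₂.tensor M₁).Hom M₂₁) {ι₁ ι₂ : Type*} [Fintype ι₁]
    [Fintype ι₂] (T₁ : TriangularIdempotents (⊥ : Subalgebra k A₁) ι₁)
    (T₂ : TriangularIdempotents (⊥ : Subalgebra k A₂) ι₂) :
    TriangularIdempotents (subalgebra ρ) (ι₂ ⊕ Unit ⊕ ι₁) where
  e
    | .inl x => ⟨T₂.e x, 0, 0, 0, 0, 0⟩
    | .inr (.inl _) => ⟨0, 0, 0, 1, 0, 0⟩
    | .inr (.inr y) => ⟨0, 0, 0, 0, 0, T₁.e y⟩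
  -- The levels stack the three blocks in the order of the rows: those of `A₂` are at most the
  -- supremum, then come the middle idempotent and the shifted levels of `A₁`.
  level
    | .inl x => T₂.level x
    | .inr (.inl _) => Finset.univ.sup T₂.level + 1
    | .inr (.inr y) => Finset.univ.sup T₂.level + 2 + T₁.level y
  sum_e := by
    simp only [Fintype.sum_sum_type, sum_diag_a₂, sum_diag_a₁, T₁.sum_e, T₂.sum_e]
    ext <;> simp
  e_mul_self := by
    rintro (x | _ | y) <;> ext <;> simp [T₁.e_mul_self, T₂.e_mul_self, pair_zero_left]
  e_mul_of_ne := by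
    rintro (x | _ | y) (x' | _ | y') h
    · have h' : x ≠ x' := fun hx => h (by rw [hx])
      ext <;> simp [pair_zero_left, T₂.e_mul_of_ne _ _ h']
    iterate 3 ext <;> simp [pair_zero_left]
    · exact absurd rfl h
    iterate 3 ext <;> simp [pair_zero_left]
    · have h' : y ≠ y' := fun hx => h (by rw [hx])
      ext <;> simp [pair_zero_left, T₁.e_mul_of_ne _ _ h']
  comm := by
    rintro i s ⟨h₁, h₂, h₃, c, h₄, h₅⟩
    rcases i with x | _ | y <;> ext <;>
      simp [h₁, h₂, h₃, h₄, h₅, pair_zero_right, Algebra.commutes]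
  triangular := by
    have hsup (x) := Finset.le_sup (f := T₂.level) (Finset.mem_univ x)
    rintro (x | _ | y) (x' | _ | y') h hl r
    · have h' : x ≠ x' := fun hx => h (by rw [hx])
      ext <;> simp [pair_zero_left, pair_zero_right, T₂.triangular _ _ h' hl]
    · have := hsup x; lia
    · have := hsup x; lia
    · ext <;> simp [pair_zero_left, pair_zero_right]
    · exact absurd rfl h
    · lia
    · ext <;> simp [pair_zero_left, pair_zero_right]
    · ext <;> simp [pair_zero_left, pair_zero_right]
    · have h' : y ≠ y' := fun hx => h (by rw [hx])
      ext <;> simp [pair_zero_left, pair_zero_right, T₁.triangular _ _ h' (by lia)]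
  diagonal := by
    rintro (x | _ | y) r
    · obtain ⟨s, hs, h⟩ := T₂.diagonal x r.a₂
      obtain ⟨c, rfl⟩ := Algebra.mem_bot.1 hs
      refine ⟨algebraMap k _ c, algebraMap_mem _ c, ?_⟩
      ext <;> simp [pair_zero_left, pair_zero_right, h, Algebra.algebraMap_eq_smul_one]
    -- The subalgebra contains the whole middle algebra, so one idempotent suffices here and no
    -- vertices of `Q` are needed.
    · refine ⟨⟨0, 0, 0, r.b, 0, 0⟩, ⟨rfl, rfl, rfl, 0, by simp, by simp⟩, ?_⟩
      ext <;> simp [pair_zero_left, pair_zero_right]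
    · obtain ⟨s, hs, h⟩ := T₁.diagonal y r.a₁
      obtain ⟨c, rfl⟩ := Algebra.mem_bot.1 hs
      refine ⟨algebraMap k _ c, algebraMap_mem _ c, ?_⟩
      ext <;> simp [pair_zero_left, pair_zero_right, h, Algebra.algebraMap_eq_smul_one]

end TriMatrix

end TriMatrixIdempotents

/-! ### Vertex idempotents and vertex coefficients of quiver algebras -/

section AcyclicPathAlgebra

variable {k : Type u} [Field k] {V : Type u} [Quiver.{u} V]

/-- The number of vertices that can be reached from a vertex. -/
noncomputable def reachCard (a : V) : ℕ := {b : V | Nonempty (Quiver.Path a b)}.ncard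

/-- Everything reachable from `b` is reachable from `a`, while `a` itself is not reachable from `b`,
since a way back would close a nontrivial cycle. -/
lemma reachCard_lt [Finite V] (hV : IsAcyclic V) {a b : V} (p : Quiver.Path a b) (hab : a ≠ b) :
    reachCard b < reachCard a := by
  refine Set.ncard_lt_ncard ⟨?_, fun h => ?_⟩ (Set.toFinite _)
  · rintro c ⟨q⟩
    exact ⟨p.comp q⟩
  · obtain ⟨q⟩ := h (show a ∈ {c : V | Nonempty (Quiver.Path a c)} from ⟨.nil⟩)
    have := hV _ (p.comp q)
    rw [Quiver.Path.length_comp] at this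
    exact hab (Quiver.Path.eq_of_length_zero p (by lia))

namespace PathAlgebra

open Classical in
lemma coeff_ofPath (p q : QPath V) : coeff (ofPath k p) q = if p = q then 1 else 0 := by
  rw [coeff, ofPath, Module.Basis.repr_self, Finsupp.single_apply]

lemma ofPath_mul [Fintype V] (q p : QPath V) : ofPath k q * ofPath k p = pathMul k q p :=
  mulHom_ofPath q p

variable (k) in
/-- The idempotent of a vertex. -/
noncomputable def vertex (v : V) : PathAlgebra k V := ofPath k ⟨v, v, .nil⟩

variable [Fintype V]

lemma vertex_mul_ofPath [DecidableEq V] (v : V) (p : QPath V) :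
    vertex k v * ofPath k p = if p.tgt = v then ofPath k p else 0 := by
  obtain ⟨a, b, p⟩ := p
  rw [vertex, ofPath_mul, pathMul]
  split_ifs with h
  · dsimp only at h
    subst h
    simp
  · rfl

lemma vertex_mul_vertex [DecidableEq V] (v w : V) :
    vertex k v * vertex k w = if w = v then vertex k w else 0 :=
  vertex_mul_ofPath v _

lemma ofPath_mul_vertex [DecidableEq V] (v : V) (p : QPath V) :
    ofPath k p * vertex k v = if p.src = v then ofPath k p else 0 := by
  obtain ⟨a, b, p⟩ := p
  rw [vertex, ofPath_mul, pathMul]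
  by_cases h : a = v
  · subst h
    simp
  · simp [h, Ne.symm h]

lemma vertex_mul_mul_vertex_of_isEmpty {v w : V} (h : IsEmpty (Quiver.Path w v))
    (x : PathAlgebra k V) : vertex k v * x * vertex k w = 0 := by
  classical
  have : LinearMap.mulRight k (vertex k w) ∘ₗ LinearMap.mulLeft k (vertex k v) = 0 := by
    refine hom_ext fun p => ?_
    obtain ⟨a, b, p⟩ := p
    simp only [LinearMap.comp_apply, LinearMap.mulLeft_apply, LinearMap.mulRight_apply,
      vertex_mul_ofPath, LinearMap.zero_apply]
    split_ifs with h₁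
    · subst h₁
      rw [ofPath_mul_vertex, if_neg]
      rintro rfl
      exact h.elim p
    · rw [zero_mul]
  exact LinearMap.congr_fun this x

/-- By acyclicity the stationary path is the only path from `v` to `v`, so the diagonal blocks are
one-dimensional. -/
lemma vertex_mul_mul_vertex_self (hV : IsAcyclic V) (v : V) (x : PathAlgebra k V) :
    vertex k v * x * vertex k v = x.coeff ⟨v, v, .nil⟩ • vertex k v := by
  classical
  have : LinearMap.mulRight k (vertex k v) ∘ₗ LinearMap.mulLeft k (vertex k v) =
      ((basis k V).coord ⟨v, v, .nil⟩).smulRight (vertex k v) := by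
    refine hom_ext fun p => ?_
    obtain ⟨a, b, p⟩ := p
    have hr : vertex k v * ofPath k ⟨a, b, p⟩ * vertex k v =
        coeff (ofPath k ⟨a, b, p⟩) ⟨v, v, .nil⟩ • vertex k v := by
      rw [vertex_mul_ofPath, coeff_ofPath]
      by_cases hb : b = v
      · subst hb
        by_cases ha : a = b
        · subst ha
          rw [Quiver.Path.eq_nil_of_length_zero p (hV _ p), if_pos rfl, if_pos rfl, one_smul,
            ofPath_mul_vertex, if_pos rfl, vertex]
        · rw [if_pos rfl, ofPath_mul_vertex, if_neg ha, if_neg, zero_smul]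
          intro h
          exact ha (congrArg QPath.src h)
      · rw [if_neg hb, if_neg, zero_mul, zero_smul]
        intro h
        exact hb (congrArg QPath.tgt h)
    exact hr
  exact LinearMap.congr_fun this x

end PathAlgebra

section Quotient

variable [Fintype V] (I : Ideal (PathAlgebra k V)) [I.IsTwoSided]

/-- The idempotents of the vertices of an acyclic quiver are triangular. -/
noncomputable def vertexIdempotents (hV : IsAcyclic V) :
    TriangularIdempotents (⊥ : Subalgebra k (PathAlgebra k V ⧸ I)) V where
  e v := Ideal.Quotient.mk I (PathAlgebra.vertex k v)
  level := reachCard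
  sum_e := by
    rw [← map_sum, ← map_one (Ideal.Quotient.mk I)]
    rfl
  e_mul_self v := by
    classical
    rw [← map_mul, PathAlgebra.vertex_mul_vertex, if_pos rfl]
  e_mul_of_ne v w h := by
    classical
    rw [← map_mul, PathAlgebra.vertex_mul_vertex, if_neg h.symm, map_zero]
  comm v s hs := by
    obtain ⟨c, rfl⟩ := Algebra.mem_bot.1 hs
    exact (Algebra.commutes c _).symm
  triangular v w h hl x := by
    obtain ⟨x, rfl⟩ := Ideal.Quotient.mk_surjective x
    rw [← map_mul, ← map_mul, PathAlgebra.vertex_mul_mul_vertex_of_isEmpty, map_zero]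
    -- Products compose from right to left, so a nonzero block needs a path from `w` to `v`, which
    -- would make the level of `v` smaller than that of `w`.
    refine ⟨fun p => ?_⟩
    exact (reachCard_lt hV p h.symm).not_ge hl
  diagonal v x := by
    obtain ⟨x, rfl⟩ := Ideal.Quotient.mk_surjective x
    refine ⟨_, Algebra.mem_bot.2 ⟨x.coeff ⟨v, v, .nil⟩, rfl⟩, ?_⟩
    rw [← map_mul, ← map_mul, PathAlgebra.vertex_mul_mul_vertex_self hV, ← Algebra.commutes,
      ← Algebra.smul_def]
    rfl

variable {I}

/-- The coefficient of a stationary path is well defined modulo an admissible ideal. -/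
noncomputable def vertexCoeff (hI : IsAdmissible I) (v : V) : (PathAlgebra k V ⧸ I) →ₗ[k] k :=
  (I.restrictScalars k).liftQ ((PathAlgebra.basis k V).coord ⟨v, v, .nil⟩)
    fun x hx => hI.2 x hx _ (by simp)

lemma vertexCoeff_mk (hI : IsAdmissible I) (v : V) (x : PathAlgebra k V) :
    vertexCoeff hI v (Ideal.Quotient.mk I x) = x.coeff ⟨v, v, .nil⟩ := rfl

lemma vertexCoeff_vertex [DecidableEq V] (hI : IsAdmissible I) (v w : V) :
    vertexCoeff hI v (Ideal.Quotient.mk I (PathAlgebra.vertex k w)) = if w = v then 1 else 0 := by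
  classical
  rw [vertexCoeff_mk, PathAlgebra.vertex, PathAlgebra.coeff_ofPath]
  by_cases h : w = v
  · rw [if_pos h, if_pos (by rw [h])]
  · rw [if_neg h, if_neg fun h' => h (congrArg QPath.src h')]

lemma vertexCoeff_one (hI : IsAdmissible I) (v : V) : vertexCoeff hI v 1 = 1 := by
  classical
  have h : (1 : PathAlgebra k V ⧸ I) = ∑ w, Ideal.Quotient.mk I (PathAlgebra.vertex k w) := by
    rw [← map_sum, ← map_one (Ideal.Quotient.mk I)]
    rfl
  rw [h, map_sum]
  simp [vertexCoeff_vertex]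

end Quotient

end AcyclicPathAlgebra

/-! ### Projective bimodules and their tensor powers -/

namespace Bimodule

variable {k : Type u} [Field k] {L S R : Type u} [Ring L] [Algebra k L] [Ring S] [Algebra k S]
  [Ring R] [Algebra k R]

lemma env_smul (M : Bimodule k L R) (l : L) (r : Rᵐᵒᵖ) (m : M) :
    (l ⊗ₜ[k] r : L ⊗[k] Rᵐᵒᵖ) • m = l • r • m :=
  TensorProduct.Algebra.smul_def l r m

lemma left_smul_eq (M : Bimodule k L R) (l : L) (m : M) :
    l • m = (l ⊗ₜ[k] (1 : Rᵐᵒᵖ) : L ⊗[k] Rᵐᵒᵖ) • m := by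
  rw [env_smul, one_smul]

lemma right_smul_eq (M : Bimodule k L R) (r : Rᵐᵒᵖ) (m : M) :
    r • m = ((1 : L) ⊗ₜ[k] r : L ⊗[k] Rᵐᵒᵖ) • m := by
  rw [env_smul, one_smul]

/-- A map that is linear on both sides is linear over the enveloping algebra. -/
def envHom {M N : Bimodule k L R} (f : M →+ N) (hl : ∀ (l : L) m, f (l • m) = l • f m)
    (hr : ∀ (r : Rᵐᵒᵖ) m, f (r • m) = r • f m) : M →ₗ[L ⊗[k] Rᵐᵒᵖ] N where
  __ := f
  map_smul' x m := by
    change f (x • m) = x • f m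
    induction x with
    | zero =>
      exact (congrArg f (zero_smul (L ⊗[k] Rᵐᵒᵖ) m)).trans
        ((map_zero f).trans (zero_smul (L ⊗[k] Rᵐᵒᵖ) (f m)).symm)
    | tmul l r => rw [env_smul, env_smul, hl, hr]
    | add x y hx hy => rw [add_smul, add_smul, map_add, hx, hy]

/-- A module over the enveloping algebra as a bimodule. -/
def ofEnv (k L R : Type u) [Field k] [Ring L] [Algebra k L] [Ring R] [Algebra k R]
    (X : Type u) [AddCommGroup X] [Module (L ⊗[k] Rᵐᵒᵖ) X] : Bimodule k L R :=
  letI : Module k X := Module.compHom X (algebraMap k (L ⊗[k] Rᵐᵒᵖ))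
  letI : Module L X :=
    Module.compHom X (Algebra.TensorProduct.includeLeft : L →ₐ[k] L ⊗[k] Rᵐᵒᵖ).toRingHom
  letI : Module Rᵐᵒᵖ X :=
    Module.compHom X (Algebra.TensorProduct.includeRight : Rᵐᵒᵖ →ₐ[k] L ⊗[k] Rᵐᵒᵖ).toRingHom
  { carrier := X
    towerLeft := ⟨fun c l x => by
      change (Algebra.TensorProduct.includeLeft : L →ₐ[k] L ⊗[k] Rᵐᵒᵖ) (c • l) • x =
        algebraMap k (L ⊗[k] Rᵐᵒᵖ) c •
          (Algebra.TensorProduct.includeLeft : L →ₐ[k] L ⊗[k] Rᵐᵒᵖ) l • x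
      rw [map_smul, smul_smul, Algebra.smul_def]⟩
    towerRight := ⟨fun c l x => by
      change (Algebra.TensorProduct.includeRight : Rᵐᵒᵖ →ₐ[k] L ⊗[k] Rᵐᵒᵖ) (c • l) • x =
        algebraMap k (L ⊗[k] Rᵐᵒᵖ) c •
          (Algebra.TensorProduct.includeRight : Rᵐᵒᵖ →ₐ[k] L ⊗[k] Rᵐᵒᵖ) l • x
      rw [map_smul, smul_smul, Algebra.smul_def]⟩
    comm := ⟨fun l r x => by
      change (l ⊗ₜ[k] (1 : Rᵐᵒᵖ)) • ((1 : L) ⊗ₜ[k] r) • x =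
        ((1 : L) ⊗ₜ[k] r) • (l ⊗ₜ[k] (1 : Rᵐᵒᵖ)) • x
      simp [smul_smul]⟩ }

/-- Projectivity over the enveloping algebra can be tested on bimodules. -/
lemma projective_of_forall_section (P : Bimodule k L R)
    (h : ∀ (X : Bimodule k L R) (f : X →ₗ[L ⊗[k] Rᵐᵒᵖ] P), Function.Surjective f →
      ∃ g : P →ₗ[L ⊗[k] Rᵐᵒᵖ] X, ∀ p, f (g p) = p) :
    Module.Projective (L ⊗[k] Rᵐᵒᵖ) P := by
  refine .of_lifting_property'' fun f hf => ?_
  -- The action that `X` gets from its two one-sided actions must be compared with the original one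
  -- on the free module; `e` is the identity map between the two.
  let X := ofEnv k L R (P →₀ L ⊗[k] Rᵐᵒᵖ)
  let e₀ : X → (P →₀ L ⊗[k] Rᵐᵒᵖ) := fun x => x
  have hX (r : L ⊗[k] Rᵐᵒᵖ) (x : X) : e₀ (r • x) = r • e₀ x := by
    induction r with
    | zero =>
      exact (congrArg e₀ (zero_smul (L ⊗[k] Rᵐᵒᵖ) x)).trans
        (zero_smul (L ⊗[k] Rᵐᵒᵖ) (e₀ x)).symm
    | tmul l r =>
      have h₁ : (l ⊗ₜ[k] (1 : Rᵐᵒᵖ) * (1 : L) ⊗ₜ[k] r : L ⊗[k] Rᵐᵒᵖ) = l ⊗ₜ[k] r := by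
        rw [Algebra.TensorProduct.tmul_mul_tmul, mul_one, one_mul]
      exact (congrArg e₀ (env_smul X l r x)).trans
        ((mul_smul _ _ (e₀ x)).symm.trans (congrArg (· • e₀ x) h₁))
    | add r s hr hs =>
      exact (congrArg e₀ (add_smul r s x)).trans
        ((congrArg₂ (· + ·) hr hs).trans (add_smul r s (e₀ x)).symm)
  let e : X →ₗ[L ⊗[k] Rᵐᵒᵖ] (P →₀ L ⊗[k] Rᵐᵒᵖ) :=
    { toFun := e₀
      map_add' _ _ := rfl
      map_smul' := hX }
  obtain ⟨g, hg⟩ := h X (f ∘ₗ e) hf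
  exact ⟨e ∘ₗ g, LinearMap.ext hg⟩

/-- The bimodule of right linear maps. -/
def homRight (N : Bimodule k S R) (Y : Bimodule k L R) : Bimodule k L S :=
  letI : SMulCommClass Rᵐᵒᵖ L Y := SMulCommClass.symm _ _ _
  letI : SMulCommClass Rᵐᵒᵖ k Y := IsScalarTower.to_smulCommClass'
  letI : Module Sᵐᵒᵖ (N →ₗ[Rᵐᵒᵖ] Y) :=
    { smul s φ :=
        { toFun n := φ (s.unop • n)
          map_add' m n := by rw [smul_add, map_add]
          map_smul' r n := by rw [smul_comm, map_smul]; rfl }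
      one_smul φ := LinearMap.ext fun n => congrArg φ (one_smul S n)
      mul_smul s t φ := LinearMap.ext fun n => congrArg φ (mul_smul t.unop s.unop n)
      smul_zero s := rfl
      smul_add s φ ψ := rfl
      add_smul s t φ := LinearMap.ext fun n =>
        (congrArg φ (add_smul s.unop t.unop n)).trans (map_add φ _ _)
      zero_smul φ := LinearMap.ext fun n => (congrArg φ (zero_smul S n)).trans (map_zero φ) }
  { carrier := N →ₗ[Rᵐᵒᵖ] Y
    towerLeft := ⟨fun c l φ => LinearMap.ext fun n => smul_assoc c l (φ n)⟩
    towerRight := ⟨fun c s φ => LinearMap.ext fun n => by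
      change φ ((c • s.unop) • n) = c • φ (s.unop • n)
      rw [smul_assoc, ← algebraMap_smul Rᵐᵒᵖ c (s.unop • n), map_smul, algebraMap_smul]⟩
    comm := ⟨fun l s φ => rfl⟩ }

lemma tensor_induction {M : Bimodule k L S} {N : Bimodule k S R} {p : M.tensor N → Prop} (h0 : p 0)
    (ht : ∀ m n, p (M.tmul N m n)) (ha : ∀ x y, p x → p y → p (x + y)) (x : M.tensor N) : p x := by
  obtain ⟨y, rfl⟩ := (tensorRel M N).mkQ_surjective x
  induction y with
  | zero => exact h0
  | tmul m n => exact ht m n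
  | add x y hx hy => exact ha _ _ hx hy

/-- A tensor product of bimodules is projective if the first factor is projective as a bimodule and
the second one is projective on the right. -/
theorem tensor_projective (M : Bimodule k L S) (N : Bimodule k S R)
    (hM : Module.Projective (L ⊗[k] Sᵐᵒᵖ) M) (hN : Module.Projective Rᵐᵒᵖ N) :
    Module.Projective (L ⊗[k] Rᵐᵒᵖ) (M.tensor N) := by
  refine projective_of_forall_section _ fun X f hf => ?_
  have hfl : ∀ (l : L) x, f (l • x) = l • f x := fun l x => by
    rw [left_smul_eq, map_smul, ← left_smul_eq]
  have hfr : ∀ (r : Rᵐᵒᵖ) x, f (r • x) = r • f x := fun l x => by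
    rw [right_smul_eq, map_smul, ← right_smul_eq]
  let fR : X →ₗ[Rᵐᵒᵖ] M.tensor N := { toFun := f, map_add' := map_add f, map_smul' := hfr }
  -- Tensor-hom adjunction: as `N` is projective on the right, `Hom_R(N, -)` keeps `f` surjective.
  -- Projectivity of `M` then lifts the unit `G : m ↦ (n ↦ m ⊗ n)` to `H`, whose adjoint `φ` is the
  -- required section of `f`.
  let F : homRight N X →ₗ[L ⊗[k] Sᵐᵒᵖ] homRight N (M.tensor N) :=
    envHom (M := homRight N X) (N := homRight N (M.tensor N))
      { toFun φ := fR ∘ₗ (show N →ₗ[Rᵐᵒᵖ] X from φ)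
        map_zero' := LinearMap.comp_zero fR
        map_add' φ ψ := LinearMap.comp_add _ _ _ }
      (fun l φ => LinearMap.ext fun n => hfl l _) (fun s φ => rfl)
  have hF : Function.Surjective F := fun φ => by
    obtain ⟨ψ, hψ⟩ := Module.projective_lifting_property fR (show N →ₗ[Rᵐᵒᵖ] M.tensor N from φ) hf
    exact ⟨ψ, hψ⟩
  let G : M →ₗ[L ⊗[k] Sᵐᵒᵖ] homRight N (M.tensor N) :=
    envHom (M := M) (N := homRight N (M.tensor N))
      { toFun m := (show N →ₗ[Rᵐᵒᵖ] M.tensor N from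
          { toFun := M.tmul N m
            map_add' := map_add _
            map_smul' r n := (smul_tmul_right r.unop m n).symm })
        map_zero' := LinearMap.ext fun n => by
          exact LinearMap.congr_fun (map_zero (M.tmul N)) n
        map_add' x y := LinearMap.ext fun n => by
          exact LinearMap.congr_fun (map_add (M.tmul N) x y) n }
      (fun l m => rfl)
      (fun s m => LinearMap.ext fun n => tmul_smul_right m s.unop n)
  obtain ⟨H, hH⟩ := Module.projective_lifting_property F G hF
  let h (m : M) : N →ₗ[Rᵐᵒᵖ] X := H m
  have hl (l : L) (m : M) (n : N) : h (l • m) n = l • h m n := by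
    change (show N →ₗ[Rᵐᵒᵖ] X from H (l • m)) n = _
    rw [left_smul_eq, map_smul, ← left_smul_eq]; rfl
  have hs (s : S) (m : M) (n : N) : h (op s • m) n = h m (s • n) := by
    change (show N →ₗ[Rᵐᵒᵖ] X from H (op s • m)) n = _
    rw [right_smul_eq, map_smul, ← right_smul_eq]; rfl
  have hadd (m m' : M) (n : N) : h (m + m') n = h m n + h m' n := by
    change (show N →ₗ[Rᵐᵒᵖ] X from H (m + m')) n = _
    rw [map_add]; rfl
  have hk (c : k) (m : M) (n : N) : h (c • m) n = c • h m n := by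
    rw [← algebraMap_smul L c m, hl, algebraMap_smul]
  have hk' (c : k) (m : M) (n : N) : h m (c • n) = c • h m n := by
    rw [← algebraMap_smul Rᵐᵒᵖ c n, map_smul, algebraMap_smul]
  let φ : (M.tensor N) →ₗ[k] X :=
    (tensorRel M N).liftQ (TensorProduct.lift (LinearMap.mk₂ k (fun m n => h m n) hadd hk
      (fun m => map_add (h m)) hk')) (by
      rw [tensorRel, Submodule.span_le]
      rintro _ ⟨m, s, n, rfl⟩
      simp [hs])
  have hφ (m : M) (n : N) : φ (M.tmul N m n) = h m n := rfl
  refine ⟨envHom (M := M.tensor N) (N := X) φ.toAddMonoidHom (fun l x => ?_) (fun r x => ?_),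
    fun x => ?_⟩
  · change φ (l • x) = l • φ x
    refine tensor_induction (p := fun x => φ (l • x) = l • φ x) (by simp) (fun m n => ?_)
      (fun x y hx hy => by rw [smul_add, map_add, map_add, smul_add, hx, hy]) x
    rw [smul_tmul_left, hφ, hφ, hl]
  · change φ (r • x) = r • φ x
    refine tensor_induction (p := fun x => φ (r • x) = r • φ x) (by simp) (fun m n => ?_)
      (fun x y hx hy => by rw [smul_add, map_add, map_add, smul_add, hx, hy]) x
    obtain ⟨r, rfl⟩ := MulOpposite.op_surjective r
    rw [smul_tmul_right, hφ, hφ, map_smul]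
  · change f (φ x) = x
    refine tensor_induction (p := fun x => f (φ x) = x) (by simp) (fun m n => ?_)
      (fun x y hx hy => by rw [map_add, map_add, hx, hy]) x
    rw [hφ]
    have := LinearMap.congr_fun hH m
    exact LinearMap.congr_fun (show fR ∘ₗ h m = G m from this) n

/-- The bimodule coinduced from a right module. -/
def coind (k L R : Type u) [Field k] [Ring L] [Algebra k L] [Ring R] [Algebra k R]
    (X : Type u) [AddCommGroup X] [Module k X] [Module Rᵐᵒᵖ X] [IsScalarTower k Rᵐᵒᵖ X] :
    Bimodule k L R :=
  letI : SMulCommClass k Rᵐᵒᵖ X := IsScalarTower.to_smulCommClass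
  letI : Module L (L →ₗ[k] X) :=
    { smul l φ := φ ∘ₗ LinearMap.mulRight k l
      one_smul φ := LinearMap.ext fun n => congrArg φ (mul_one n)
      mul_smul s t φ := LinearMap.ext fun n => congrArg φ (mul_assoc n s t).symm
      smul_zero s := rfl
      smul_add s φ ψ := rfl
      add_smul s t φ := LinearMap.ext fun n =>
        (congrArg φ (mul_add n s t)).trans (map_add φ _ _)
      zero_smul φ := LinearMap.ext fun n => (congrArg φ (mul_zero n)).trans (map_zero φ) }
  { carrier := L →ₗ[k] X
    towerLeft := ⟨fun c l φ => LinearMap.ext fun n => by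
      change φ (n * c • l) = c • φ (n * l)
      rw [mul_smul_comm, map_smul]⟩
    towerRight := ⟨fun c r φ => LinearMap.ext fun n => smul_assoc c r (φ n)⟩
    comm := ⟨fun l s φ => rfl⟩ }

/-- Projective bimodules are projective on the right. -/
theorem projective_right (N : Bimodule k L R) (hN : Module.Projective (L ⊗[k] Rᵐᵒᵖ) N) :
    Module.Projective Rᵐᵒᵖ N := by
  refine .of_lifting_property'' fun f hf => ?_
  have hfk (c : k) (x) : f (c • x) = c • f x := by
    rw [← algebraMap_smul Rᵐᵒᵖ c x, map_smul, algebraMap_smul]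
  let fk : (N →₀ Rᵐᵒᵖ) →ₗ[k] N := { toFun := f, map_add' := map_add f, map_smul' := hfk }
  -- Coinduction `Hom_k(L, -)` is right adjoint to forgetting the left action and preserves
  -- surjections because `k` is a field. Lifting the unit `n ↦ (l ↦ l n)` and evaluating at `1`
  -- gives a right linear section.
  let F : coind k L R (N →₀ Rᵐᵒᵖ) →ₗ[L ⊗[k] Rᵐᵒᵖ] coind k L R N :=
    envHom (M := coind k L R (N →₀ Rᵐᵒᵖ)) (N := coind k L R N)
      { toFun φ := fk ∘ₗ (show L →ₗ[k] (N →₀ Rᵐᵒᵖ) from φ)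
        map_zero' := LinearMap.comp_zero fk
        map_add' φ ψ := LinearMap.comp_add _ _ _ }
      (fun l φ => rfl) (fun s φ => LinearMap.ext fun n => map_smul f s _)
  have hF : Function.Surjective F := fun φ => by
    obtain ⟨ψ, hψ⟩ := Module.projective_lifting_property fk (show L →ₗ[k] N from φ) hf
    exact ⟨ψ, hψ⟩
  let G : N →ₗ[L ⊗[k] Rᵐᵒᵖ] coind k L R N :=
    envHom (M := N) (N := coind k L R N)
      { toFun n := (show L →ₗ[k] N from LinearMap.toSpanSingleton L N n |>.restrictScalars k)
        map_zero' := LinearMap.ext fun l => smul_zero l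
        map_add' x y := LinearMap.ext fun l => smul_add l x y }
      (fun l m => LinearMap.ext fun l' => (mul_smul l' l m).symm)
      (fun r m => LinearMap.ext fun l => smul_comm l r m)
  obtain ⟨H, hH⟩ := Module.projective_lifting_property F G hF
  let h (n : N) : L →ₗ[k] (N →₀ Rᵐᵒᵖ) := H n
  refine ⟨⟨⟨fun n => h n 1, fun m n => ?_⟩, fun r n => ?_⟩, LinearMap.ext fun n => ?_⟩
  · change (show L →ₗ[k] (N →₀ Rᵐᵒᵖ) from H (m + n)) 1 = _
    rw [map_add]; rfl
  · change (show L →ₗ[k] (N →₀ Rᵐᵒᵖ) from H (r • n)) 1 = _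
    rw [right_smul_eq, map_smul, ← right_smul_eq]; rfl
  · have := LinearMap.congr_fun hH n
    exact (LinearMap.congr_fun (show fk ∘ₗ h n = G n from this) 1).trans (one_smul L n)

theorem tpow_projective (M : Bimodule k R R) (hM : Module.Projective (R ⊗[k] Rᵐᵒᵖ) M) (n : ℕ) :
    Module.Projective (R ⊗[k] Rᵐᵒᵖ) (M.tpow (n + 1)) := by
  induction n with
  | zero => exact hM
  | succ n ih => exact tensor_projective M _ hM (projective_right _ ih)

/-- A functional that is semilinear along a character does not vanish on tensor powers. -/
theorem not_subsingleton_tpow (M : Bimodule k R R) (π : R → k) (χ : M →ₗ[k] k)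
    (hl : ∀ (r : R) m, χ (r • m) = π r * χ m) (hr : ∀ (r : R) m, χ (op r • m) = π r * χ m)
    {m : M} (hm : χ m ≠ 0) (n : ℕ) : ¬ Subsingleton (M.tpow (n + 1)) := by
  suffices h : ∃ ψ : M.tpow (n + 1) →ₗ[k] k, (∀ (r : R) t, ψ (r • t) = π r * ψ t) ∧
      ∃ t, ψ t ≠ 0 by
    obtain ⟨ψ, -, t, ht⟩ := h
    exact fun _ => ht (by rw [Subsingleton.elim t 0, map_zero])
  induction n with
  | zero => exact ⟨χ, hl, m, hm⟩
  | succ n ih =>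
    obtain ⟨ψ, hψ, t, ht⟩ := ih
    let N := M.tpow (n + 1)
    -- The product `χ ⊗ ψ` is balanced because `π` governs both the right action under `χ` and the
    -- left action under `ψ`; only left semilinearity has to be carried through the induction.
    let φ : M.tensor N →ₗ[k] k :=
      (tensorRel M N).liftQ (TensorProduct.lift ((LinearMap.mul k k).compl₁₂ χ ψ)) (by
        rw [tensorRel, Submodule.span_le]
        rintro _ ⟨m, s, n, rfl⟩
        simp only [SetLike.mem_coe, LinearMap.mem_ker, map_sub, TensorProduct.lift.tmul,
          LinearMap.compl₁₂_apply, LinearMap.mul_apply', hr, hψ]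
        ring)
    have hφ (x : M) (y : N) : φ (M.tmul N x y) = χ x * ψ y := rfl
    refine ⟨φ, fun r x => ?_, M.tmul N m t, mul_ne_zero hm ht⟩
    change φ (r • x) = π r * φ x
    refine tensor_induction (p := fun x => φ (r • x) = π r * φ x) (by simp) (fun x y => ?_)
      (fun x y hx hy => by rw [smul_add, map_add, map_add, mul_add, hx, hy]) x
    rw [smul_tmul_left, hφ, hφ, hl, mul_assoc]

end Bimodule

/-! ### Factorization through free modules along a corner -/

/-- A map factors through a free module if it factors, semilinearly along a non-unital ring
homomorphism onto a corner, through a projective module. -/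
lemma exists_factorization {R R' M M' : Type*} [Ring R] [Ring R'] [AddCommGroup M] [Module R M]
    [AddCommGroup M'] [Module R' M'] [Module.Projective R' M'] (j : R' →ₙ+* R) (u : M' →+ M)
    (v : M →+ M') (hu : ∀ r m, u (r • m) = j r • u m)
    (hv : ∀ r, ∃ r', r * j 1 = j r' ∧ ∀ m, v (r • m) = r' • v m) :
    ∃ (t : M →ₗ[R] (M' →₀ R)) (w : (M' →₀ R) →ₗ[R] M), ∀ m, w (t m) = u (v m) := by
  obtain ⟨s, hs⟩ := Module.projective_def.1 ‹Module.Projective R' M'›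
  refine ⟨{ toFun m := (s (v m)).mapRange j (map_zero j)
            map_add' x y := ?_
            -- The coordinates of `v m` in a splitting of `M'` are moved to `R` by `j`. This is
            -- `R`-linear since `j r' = r * j 1`, and `j 1` is a left unit on the image of `j`.
            map_smul' r x := ?_ }, Finsupp.linearCombination R u, fun m => ?_⟩
  · ext i
    simp
  · obtain ⟨r', h₁, h₂⟩ := hv r
    ext i
    simp only [h₂, map_smul, Finsupp.mapRange_apply, Finsupp.smul_apply, smul_eq_mul, map_mul,
      RingHom.id_apply]
    rw [← h₁, mul_assoc, ← map_mul, one_mul]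
  · change Finsupp.linearCombination R u ((s (v m)).mapRange j (map_zero j)) = _
    rw [Finsupp.linearCombination_apply, Finsupp.sum_mapRange_index (by simp)]
    conv_rhs => rw [← hs (v m), Finsupp.linearCombination_apply, Finsupp.sum, map_sum]
    exact Finset.sum_congr rfl fun i _ => (hu _ _).symm

/-- The factorization criterion for bimodules, tested on pure tensors. -/
lemma exists_env_factorization {k L R : Type u} [Field k] [Ring L] [Algebra k L] [Ring R]
    [Algebra k R] {M : Bimodule k L R} {R' M' : Type*} [Ring R'] [AddCommGroup M'] [Module R' M']
    [Module.Projective R' M'] (j : R' →ₙ+* L ⊗[k] Rᵐᵒᵖ) (u : M' →+ M) (v : M →+ M')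
    (hu : ∀ r m, u (r • m) = j r • u m)
    (hv : ∀ (l : L) (r : R), ∃ r', (l ⊗ₜ[k] op r) * j 1 = j r' ∧
      ∀ m, v (l • op r • m) = r' • v m) :
    ∃ (t : M →ₗ[L ⊗[k] Rᵐᵒᵖ] (M' →₀ L ⊗[k] Rᵐᵒᵖ))
      (w : (M' →₀ L ⊗[k] Rᵐᵒᵖ) →ₗ[L ⊗[k] Rᵐᵒᵖ] M), ∀ m, w (t m) = u (v m) := by
  refine exists_factorization j u v hu fun r => ?_
  induction r with
  | zero =>
    exact ⟨0, by rw [zero_mul, map_zero], fun m =>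
      (congrArg v (zero_smul (L ⊗[k] Rᵐᵒᵖ) m)).trans ((map_zero v).trans (zero_smul R' _).symm)⟩
  | tmul l r =>
    obtain ⟨r', h₁, h₂⟩ := hv l r.unop
    exact ⟨r', h₁, fun m => (congrArg v (M.env_smul l r m)).trans (h₂ m)⟩
  | add r s hr hs =>
    obtain ⟨r', hr, hr'⟩ := hr
    obtain ⟨s', hs, hs'⟩ := hs
    refine ⟨r' + s', by rw [add_mul, hr, hs, map_add], fun m => ?_⟩
    rw [add_smul, map_add, hr', hs', add_smul]

/-! ### The bimodule `A/B` -/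

section Quot

variable {k : Type u} [Field k] {A : Type u} [Ring A] [Algebra k A]

/-- The class of an element in `A / B`. -/
noncomputable def quotMk (B : Subalgebra k A) : A →ₗ[k] quotBimodule B :=
  (Subalgebra.toSubmodule B).mkQ

variable {B : Subalgebra k A}

lemma quotMk_surjective : Function.Surjective (quotMk B) := Submodule.mkQ_surjective _

lemma quotMk_eq_zero {a : A} : quotMk B a = 0 ↔ a ∈ B :=
  Submodule.Quotient.mk_eq_zero (Subalgebra.toSubmodule B)

lemma smul_quotMk (b : B) (a : A) : b • quotMk B a = quotMk B (b * a) := rfl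

lemma op_smul_quotMk (b : B) (a : A) : op b • quotMk B a = quotMk B (a * b) := rfl

lemma env_smul_quotMk (b c : B) (a : A) :
    (b ⊗ₜ[k] op c : B ⊗[k] Bᵐᵒᵖ) • quotMk B a = quotMk B (b * (a * c)) := by
  rw [Bimodule.env_smul, op_smul_quotMk, smul_quotMk]

/-- A map out of `A / B`. -/
noncomputable def quotLift (B : Subalgebra k A) {M : Type*} [AddCommGroup M] [Module k M]
    (f : A →ₗ[k] M) (hf : ∀ b ∈ B, f b = 0) : quotBimodule B →ₗ[k] M :=
  (Subalgebra.toSubmodule B).liftQ f hf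

@[simp]
lemma quotLift_quotMk {M : Type*} [AddCommGroup M] [Module k M]
    (f : A →ₗ[k] M) (hf : ∀ b ∈ B, f b = 0) (a : A) : quotLift B f hf (quotMk B a) = f a := rfl

end Quot

/-! ### Projectivity of `A/B` over the enveloping algebra -/

namespace TriMatrix

variable {k : Type u} [Field k] {A₂ B A₁ : Type u} [Ring A₂] [Algebra k A₂] [Ring B] [Algebra k B]
  [Ring A₁] [Algebra k A₁] {M₂ : Bimodule k A₂ B} {M₁ : Bimodule k B A₁} {M₂₁ : Bimodule k A₂ A₁}
  (ρ : (M₂.tensor M₁).Hom M₂₁)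

/-- The inclusion of the middle algebra. -/
def midHom : B →ₙ+* subalgebra ρ where
  toFun b := ⟨⟨0, 0, 0, b, 0, 0⟩, rfl, rfl, rfl, 0, by simp, by simp⟩
  map_mul' x y := Subtype.ext (by ext <;> simp [pair_zero_left])
  map_zero' := rfl
  map_add' x y := Subtype.ext (by ext <;> simp)

@[simp]
lemma coe_midHom (b : B) : (midHom ρ b : TriMatrix ρ) = ⟨0, 0, 0, b, 0, 0⟩ := rfl

/-- The idempotent `E = diag(1, 0, 1)`. -/
def outer : subalgebra ρ := ⟨⟨1, 0, 0, 0, 0, 1⟩, rfl, rfl, rfl, 1, by simp, by simp⟩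

@[simp]
lemma coe_outer : (outer ρ : TriMatrix ρ) = ⟨1, 0, 0, 0, 0, 1⟩ := rfl

lemma outer_mul_outer : outer ρ * outer ρ = outer ρ :=
  Subtype.ext (by ext <;> simp [pair_zero_left])

lemma mul_midHom_one (s : subalgebra ρ) : s * midHom ρ 1 = midHom ρ s.1.b := by
  obtain ⟨s, h₁, h₂, h₃, c, h₄, h₅⟩ := s
  exact Subtype.ext (by ext <;> simp [h₁, h₃, pair_zero_left])

lemma midHom_one_mul (s : subalgebra ρ) : midHom ρ 1 * s = midHom ρ s.1.b := by
  obtain ⟨s, h₁, h₂, h₃, c, h₄, h₅⟩ := s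
  exact Subtype.ext (by ext <;> simp [h₁, h₃, pair_zero_left])

lemma exists_scalar (s : subalgebra ρ) : ∃ c : k, s.1.a₂ = algebraMap k A₂ c ∧
    s.1.a₁ = algebraMap k A₁ c ∧ s * outer ρ = c • outer ρ ∧ outer ρ * s = c • outer ρ := by
  obtain ⟨s, h₁, h₂, h₃, c, h₄, h₅⟩ := s
  refine ⟨c, h₄, h₅, Subtype.ext ?_, Subtype.ext ?_⟩ <;> ext <;>
    simp [h₁, h₂, h₃, h₄, h₅, pair_zero_left, Algebra.algebraMap_eq_smul_one]

/-- The projection to the entry in `M₁`. -/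
def entry₁ : TriMatrix ρ →ₗ[k] M₁ where
  toFun := m₁
  map_add' _ _ := rfl
  map_smul' _ _ := rfl

/-- The projection to the entry in `M₂`. -/
def entry₂ : TriMatrix ρ →ₗ[k] M₂ where
  toFun := m₂
  map_add' _ _ := rfl
  map_smul' _ _ := rfl

/-- The inclusion of `M₁`. -/
def incl₁ : M₁ →+ TriMatrix ρ where
  toFun m := ⟨0, 0, 0, 0, m, 0⟩
  map_zero' := rfl
  map_add' _ _ := by ext <;> simp

/-- The inclusion of `M₂`. -/
def incl₂ : M₂ →+ TriMatrix ρ where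
  toFun m := ⟨0, m, 0, 0, 0, 0⟩
  map_zero' := rfl
  map_add' _ _ := by ext <;> simp

lemma tmul_mul_tmul_op {R : Type u} [Ring R] [Algebra k R] (s t s' t' : R) :
    (s ⊗ₜ[k] op t * s' ⊗ₜ[k] op t' : R ⊗[k] Rᵐᵒᵖ) = (s * s') ⊗ₜ[k] op (t' * t) :=
  Algebra.TensorProduct.tmul_mul_tmul _ _ _ _

local notation "Env" => (subalgebra ρ) ⊗[k] (subalgebra ρ)ᵐᵒᵖ

local notation "Quo" => quotBimodule (subalgebra ρ)

lemma midHom_smul (c : k) (b : B) : midHom ρ (c • b) = c • midHom ρ b :=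
  Subtype.ext (by ext <;> simp)

/-- On the `M₁` entry the right action of the subalgebra is by scalars. The corner map `b ↦ b ⊗ E`
therefore turns left projectivity of `M₁` into a factorization over the enveloping algebra. -/
lemma exists_factorization_left [Module.Projective B M₁] :
    ∃ (t : Quo →ₗ[Env] (M₁ →₀ Env)) (w : (M₁ →₀ Env) →ₗ[Env] Quo),
      ∀ a, w (t (quotMk (subalgebra ρ) a)) = quotMk (subalgebra ρ) ⟨0, 0, 0, 0, a.m₁, 0⟩ := by
  let v := quotLift (subalgebra ρ) (entry₁ ρ) fun b hb => hb.2.2.1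
  let u : M₁ →+ Quo := (quotMk (subalgebra ρ)).toAddMonoidHom.comp (incl₁ ρ)
  let j : B →ₙ+* Env :=
    { toFun b := midHom ρ b ⊗ₜ[k] op (outer ρ)
      map_mul' x y := by rw [tmul_mul_tmul_op, outer_mul_outer, map_mul]
      map_zero' := by rw [map_zero, TensorProduct.zero_tmul]
      map_add' x y := by rw [map_add, TensorProduct.add_tmul] }
  have hj (b : B) : j b = midHom ρ b ⊗ₜ[k] op (outer ρ) := rfl
  suffices h : (∀ b m, u (b • m) = j b • u m) ∧ ∀ s t : subalgebra ρ, ∃ r,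
      (s ⊗ₜ[k] op t : Env) * j 1 = j r ∧ ∀ m : Quo, v (s • op t • m) = r • v m by
    obtain ⟨t, w, h⟩ := exists_env_factorization j u v.toAddMonoidHom h.1 h.2
    exact ⟨t, w, fun a => h _⟩
  refine ⟨fun b m => ?_, fun s t => ?_⟩
  · change quotMk (subalgebra ρ) _ =
      (midHom ρ b ⊗ₜ[k] op (outer ρ) : Env) • quotMk (subalgebra ρ) _
    rw [env_smul_quotMk]
    congr 1
    ext <;> simp [incl₁, pair_zero_left]
  · obtain ⟨c, h₁, h₂, h₃, h₄⟩ := exists_scalar ρ t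
    refine ⟨c • s.1.b, ?_, fun m => ?_⟩
    · rw [hj, hj, tmul_mul_tmul_op, mul_midHom_one, h₄, midHom_smul, MulOpposite.op_smul,
        TensorProduct.tmul_smul, TensorProduct.smul_tmul']
    · obtain ⟨a, rfl⟩ := quotMk_surjective m
      change ((s : TriMatrix ρ) * (a * t)).m₁ = (c • s.1.b) • a.m₁
      simp [h₂, s.2.2.2.1, t.2.2.2.1, Algebra.algebraMap_eq_smul_one, smul_comm _ c]

/-- The mirror image: on the `M₂` entry the left action is by scalars, and the corner map is `b ↦ E
⊗ b`. -/
lemma exists_factorization_right [Module.Projective Bᵐᵒᵖ M₂] :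
    ∃ (t : Quo →ₗ[Env] (M₂ →₀ Env)) (w : (M₂ →₀ Env) →ₗ[Env] Quo),
      ∀ a, w (t (quotMk (subalgebra ρ) a)) = quotMk (subalgebra ρ) ⟨0, a.m₂, 0, 0, 0, 0⟩ := by
  let v := quotLift (subalgebra ρ) (entry₂ ρ) fun b hb => hb.1
  let u : M₂ →+ Quo := (quotMk (subalgebra ρ)).toAddMonoidHom.comp (incl₂ ρ)
  let j : Bᵐᵒᵖ →ₙ+* Env :=
    { toFun b := outer ρ ⊗ₜ[k] op (midHom ρ b.unop)
      map_mul' x y := by rw [tmul_mul_tmul_op, outer_mul_outer, MulOpposite.unop_mul, map_mul]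
      map_zero' := by rw [MulOpposite.unop_zero, map_zero, MulOpposite.op_zero,
        TensorProduct.tmul_zero]
      map_add' x y := by rw [MulOpposite.unop_add, map_add, MulOpposite.op_add,
        TensorProduct.tmul_add] }
  have hj (b : Bᵐᵒᵖ) : j b = outer ρ ⊗ₜ[k] op (midHom ρ b.unop) := rfl
  suffices h : (∀ b m, u (b • m) = j b • u m) ∧ ∀ s t : subalgebra ρ, ∃ r,
      (s ⊗ₜ[k] op t : Env) * j 1 = j r ∧ ∀ m : Quo, v (s • op t • m) = r • v m by
    obtain ⟨t, w, h⟩ := exists_env_factorization j u v.toAddMonoidHom h.1 h.2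
    exact ⟨t, w, fun a => h _⟩
  refine ⟨fun b m => ?_, fun s t => ?_⟩
  · change quotMk (subalgebra ρ) _ =
      (outer ρ ⊗ₜ[k] op (midHom ρ b.unop) : Env) • quotMk (subalgebra ρ) _
    rw [env_smul_quotMk]
    congr 1
    ext <;> simp [incl₂, pair_zero_right]
  · obtain ⟨c, h₁, h₂, h₃, h₄⟩ := exists_scalar ρ s
    refine ⟨op (c • t.1.b), ?_, fun m => ?_⟩
    · rw [hj, hj, tmul_mul_tmul_op, MulOpposite.unop_one, midHom_one_mul, h₃, MulOpposite.unop_op,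
        midHom_smul, MulOpposite.op_smul, TensorProduct.tmul_smul, TensorProduct.smul_tmul']
    · obtain ⟨a, rfl⟩ := quotMk_surjective m
      change ((s : TriMatrix ρ) * (a * t)).m₂ = op (c • t.1.b) • a.m₂
      simp [h₁, s.2.1, t.2.1, Algebra.algebraMap_eq_smul_one]

/-- On the outer part both actions are scalar, so the corner is `k • ε` with `ε = E ⊗ E`.
Projectivity over `k` is automatic, and `ε` itself serves both as projection and as inclusion. -/
lemma exists_factorization_outer :
    ∃ (t : Quo →ₗ[Env] (Quo →₀ Env)) (w : (Quo →₀ Env) →ₗ[Env] Quo),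
      ∀ a, w (t (quotMk (subalgebra ρ) a)) =
        quotMk (subalgebra ρ) ⟨a.a₂, 0, a.m₂₁, 0, 0, a.a₁⟩ := by
  let ε : Env := outer ρ ⊗ₜ[k] op (outer ρ)
  have hε : ε * ε = ε := by rw [tmul_mul_tmul_op, outer_mul_outer]
  let u : Quo →+ Quo := DistribSMul.toAddMonoidHom Quo ε
  have hu (q : Quo) : u q = outer ρ • op (outer ρ) • q :=
    Bimodule.env_smul Quo (outer ρ) (op (outer ρ)) q
  let j : k →ₙ+* Env :=
    { toFun c := c • ε
      map_mul' x y := by rw [smul_mul_smul_comm, hε]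
      map_zero' := zero_smul k ε
      map_add' x y := add_smul x y ε }
  have hj (c : k) : j c = c • (outer ρ ⊗ₜ[k] op (outer ρ) : Env) := rfl
  suffices h : (∀ c m, u (c • m) = j c • u m) ∧ ∀ s t : subalgebra ρ, ∃ r,
      (s ⊗ₜ[k] op t : Env) * j 1 = j r ∧ ∀ m : Quo, u (s • op t • m) = r • u m by
    obtain ⟨t, w, h⟩ := exists_env_factorization j u u h.1 h.2
    refine ⟨t, w, fun a => (h _).trans ?_⟩
    rw [hu, hu, op_smul_quotMk, smul_quotMk, op_smul_quotMk, smul_quotMk]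
    congr 1
    ext <;> simp [pair_zero_left, pair_zero_right]
  refine ⟨fun c m => ?_, fun s t => ?_⟩
  · obtain ⟨a, rfl⟩ := quotMk_surjective m
    rw [← map_smul, hu, hu, hj, TensorProduct.smul_tmul', Bimodule.env_smul]
    simp only [op_smul_quotMk, smul_quotMk]
    congr 1
    ext <;> simp [pair_zero_left, pair_zero_right]
  · obtain ⟨c, -, -, h₃, h₃'⟩ := exists_scalar ρ s
    obtain ⟨d, -, -, h₄', h₄⟩ := exists_scalar ρ t
    refine ⟨d * c, ?_, fun m => ?_⟩
    · rw [hj, hj, one_smul, tmul_mul_tmul_op, h₃, h₄, MulOpposite.op_smul,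
        TensorProduct.tmul_smul, ← TensorProduct.smul_tmul', mul_smul]
    · obtain ⟨a, rfl⟩ := quotMk_surjective m
      rw [hu, hu]
      simp only [op_smul_quotMk, smul_quotMk]
      rw [← map_smul]
      congr 1
      have h₅ : (outer ρ : TriMatrix ρ) * s = c • (outer ρ : TriMatrix ρ) :=
        congrArg Subtype.val h₃'
      have h₆ : (t : TriMatrix ρ) * outer ρ = d • (outer ρ : TriMatrix ρ) :=
        congrArg Subtype.val h₄'
      rw [mul_assoc (s : TriMatrix ρ), ← mul_assoc _ (s : TriMatrix ρ), h₅, mul_assoc a, h₆,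
        mul_smul_comm, mul_smul_comm, smul_mul_assoc, mul_smul]

theorem projective_quotBimodule (hM₁ : Module.Projective B M₁)
    (hM₂ : Module.Projective Bᵐᵒᵖ M₂) : Module.Projective Env Quo := by
  obtain ⟨t₁, w₁, h₁⟩ := exists_factorization_left ρ
  obtain ⟨t₂, w₂, h₂⟩ := exists_factorization_right ρ
  obtain ⟨t₃, w₃, h₃⟩ := exists_factorization_outer ρ
  refine .of_split (t₁.prod (t₂.prod t₃)) (w₁.coprod (w₂.coprod w₃)) (LinearMap.ext fun q => ?_)
  obtain ⟨a, rfl⟩ := quotMk_surjective q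
  change w₁ (t₁ _) + (w₂ (t₂ _) + w₃ (t₃ _)) = quotMk (subalgebra ρ) a
  rw [h₁, h₂, h₃, ← map_add, ← map_add, ← sub_eq_zero, ← map_sub, quotMk_eq_zero]
  -- The three pieces miss only the middle diagonal entry, which lies in the subalgebra with outer
  -- scalar `0`.
  exact ⟨by simp [sub_eq_add_neg], by simp [sub_eq_add_neg], by simp [sub_eq_add_neg], 0,
    by simp [sub_eq_add_neg], by simp [sub_eq_add_neg]⟩

end TriMatrix

/-! ### Nonvanishing tensor powers and the assembled conditions -/

namespace TriMatrix

variable {k : Type u} [Field k] {A₂ B A₁ : Type u} [Ring A₂] [Algebra k A₂] [Ring B] [Algebra k B]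
  [Ring A₁] [Algebra k A₁] {M₂ : Bimodule k A₂ B} {M₁ : Bimodule k B A₁} {M₂₁ : Bimodule k A₂ A₁}
  (ρ : (M₂.tensor M₁).Hom M₂₁)

/-- The projections to the outer diagonal entries, followed by functionals. -/
noncomputable def outerFunctional {ι₁ ι₂ : Type*} (κ₁ : ι₁ → A₁ →ₗ[k] k) (κ₂ : ι₂ → A₂ →ₗ[k] k) :
    ι₂ ⊕ ι₁ → TriMatrix ρ →ₗ[k] k
  | .inl x => κ₂ x ∘ₗ ⟨⟨a₂, fun _ _ => rfl⟩, fun _ _ => rfl⟩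
  | .inr y => κ₁ y ∘ₗ ⟨⟨a₁, fun _ _ => rfl⟩, fun _ _ => rfl⟩

variable {ι₁ ι₂ : Type*} {κ₁ : ι₁ → A₁ →ₗ[k] k} {κ₂ : ι₂ → A₂ →ₗ[k] k}

/-- The scalar `c` is shared by both outer corners and hence does not depend on `z`: differences of
these functionals vanish on the subalgebra, and any one of them restricts to the character governing
both actions. -/
lemma outerFunctional_subalgebra (h₁ : ∀ y, κ₁ y 1 = 1) (h₂ : ∀ x, κ₂ x 1 = 1)
    {s : TriMatrix ρ} (hs : s ∈ subalgebra ρ) : ∃ c : k, ∀ z,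
      outerFunctional ρ κ₁ κ₂ z s = c ∧
      ∀ a, outerFunctional ρ κ₁ κ₂ z (s * a) = c * outerFunctional ρ κ₁ κ₂ z a ∧
        outerFunctional ρ κ₁ κ₂ z (a * s) = c * outerFunctional ρ κ₁ κ₂ z a := by
  obtain ⟨-, -, -, c, h₃, h₄⟩ := hs
  refine ⟨c, ?_⟩
  rintro (x | y) <;>
    simp [outerFunctional, h₃, h₄, Algebra.algebraMap_eq_smul_one, h₁, h₂]

/-- The tensor powers of the quotient do not vanish if two functionals on the outer diagonal are
separated by some matrix. -/
theorem not_subsingleton_tpow (h₁ : ∀ y, κ₁ y 1 = 1) (h₂ : ∀ x, κ₂ x 1 = 1) {z w : ι₂ ⊕ ι₁}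
    {a : TriMatrix ρ} (ha : outerFunctional ρ κ₁ κ₂ z a ≠ outerFunctional ρ κ₁ κ₂ w a) (n : ℕ) :
    ¬ Subsingleton ((quotBimodule (subalgebra ρ)).tpow (n + 1)) := by
  let κ := outerFunctional ρ κ₁ κ₂
  have hB (b) (hb : b ∈ subalgebra ρ) : (κ z - κ w) b = 0 := by
    obtain ⟨c, hc⟩ := outerFunctional_subalgebra ρ h₁ h₂ hb
    rw [LinearMap.sub_apply, (hc z).1, (hc w).1, sub_self]
  have hm : quotLift (subalgebra ρ) (κ z - κ w) hB (quotMk (subalgebra ρ) a) ≠ 0 :=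
    sub_ne_zero.2 ha
  refine Bimodule.not_subsingleton_tpow (quotBimodule (subalgebra ρ)) (fun s => κ z s)
    (quotLift (subalgebra ρ) (κ z - κ w) hB) (fun s q => ?_) (fun s q => ?_) hm n
  all_goals
    obtain ⟨a, rfl⟩ := quotMk_surjective q
    obtain ⟨c, hc⟩ := outerFunctional_subalgebra ρ h₁ h₂ s.2
  · rw [smul_quotMk, quotLift_quotMk, quotLift_quotMk, LinearMap.sub_apply, LinearMap.sub_apply,
      ((hc z).2 a).1, ((hc w).2 a).1, (hc z).1, mul_sub]
  · rw [op_smul_quotMk, quotLift_quotMk, quotLift_quotMk, LinearMap.sub_apply, LinearMap.sub_apply,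
      ((hc z).2 a).2, ((hc w).2 a).2, (hc z).1, mul_sub]

/-- The extension by a triangular matrix algebra is strongly proj-bounded if the outer diagonal
algebras have triangular idempotents. -/
theorem isStronglyProjBounded {ι₁ ι₂ : Type*} [Fintype ι₁] [Fintype ι₂]
    (T₁ : TriangularIdempotents (⊥ : Subalgebra k A₁) ι₁)
    (T₂ : TriangularIdempotents (⊥ : Subalgebra k A₂) ι₂)
    (hM₁ : Module.Projective B M₁) (hM₂ : Module.Projective Bᵐᵒᵖ M₂) :
    IsStronglyProjBounded (subalgebra ρ) where
  finite_projDim := by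
    have := projective_quotBimodule ρ hM₁ hM₂
    have := (IsProjective.iff_projective (quotBimodule (subalgebra ρ))).1 this
    exact ⟨0, inferInstance⟩
  oneSided := .inr (Bimodule.projective_right _ (projective_quotBimodule ρ hM₁ hM₂))
  tpow_projective := by
    refine ⟨1, le_rfl, fun n hn => ?_⟩
    obtain ⟨n, rfl⟩ := Nat.exists_eq_add_of_le' hn
    exact Bimodule.tpow_projective _ (projective_quotBimodule ρ hM₁ hM₂) n
  finite_relProjDim := (triangularIdempotents ρ T₁ T₂).env.exists_hasRelProjDimLE _

end TriMatrix

end ProjBounded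

theorem mainTheorem7 {k : Type u} [Field k]
    {X₁ Q X₂ : Type u} [Quiver.{u} X₁] [Quiver.{u} Q] [Quiver.{u} X₂]
    [Fintype X₁] [Fintype Q] [Fintype X₂]
    [∀ a b : X₁, Finite (a ⟶ b)] [∀ a b : Q, Finite (a ⟶ b)] [∀ a b : X₂, Finite (a ⟶ b)]
    (hX₁ : ProjBounded.IsAcyclic X₁) (hQ : ProjBounded.IsWeaklyAcyclic Q)
    (hX₂ : ProjBounded.IsAcyclic X₂)
    (I₁ : Ideal (ProjBounded.PathAlgebra k X₁)) [I₁.IsTwoSided] (hI₁ : ProjBounded.IsAdmissible I₁)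
    (I : Ideal (ProjBounded.PathAlgebra k Q)) [I.IsTwoSided] (hI : ProjBounded.IsAdmissible I)
    (I₂ : Ideal (ProjBounded.PathAlgebra k X₂)) [I₂.IsTwoSided] (hI₂ : ProjBounded.IsAdmissible I₂)
    (M₁ : ProjBounded.Bimodule k
      (ProjBounded.PathAlgebra k Q ⧸ I) (ProjBounded.PathAlgebra k X₁ ⧸ I₁))
    (M₂ : ProjBounded.Bimodule k
      (ProjBounded.PathAlgebra k X₂ ⧸ I₂) (ProjBounded.PathAlgebra k Q ⧸ I))
    (M₂₁ : ProjBounded.Bimodule k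
      (ProjBounded.PathAlgebra k X₂ ⧸ I₂) (ProjBounded.PathAlgebra k X₁ ⧸ I₁))
    (ρ : (M₂.tensor M₁).Hom M₂₁)
    (hM₁ : Module.Projective (ProjBounded.PathAlgebra k Q ⧸ I) M₁)
    (hM₂ : Module.Projective (ProjBounded.PathAlgebra k Q ⧸ I)ᵐᵒᵖ M₂) :
    ProjBounded.IsStronglyProjBounded (ProjBounded.TriMatrix.subalgebra ρ) ∧
      (2 ≤ Fintype.card X₁ + Fintype.card X₂ →
        ¬ ProjBounded.IsBounded (ProjBounded.TriMatrix.subalgebra ρ)) := by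

  open ProjBounded TriMatrix in
  refine ⟨isStronglyProjBounded ρ (vertexIdempotents I₁ hX₁) (vertexIdempotents I₂ hX₂) hM₁ hM₂,
    fun hcard hb => ?_⟩
  obtain ⟨p, hp, hsub⟩ := hb.nilpotent
  obtain ⟨n, rfl⟩ := Nat.exists_eq_add_of_le' hp
  classical
  obtain ⟨z, w, hzw⟩ := Fintype.one_lt_card_iff.1
    (show 1 < Fintype.card (X₂ ⊕ X₁) by rw [Fintype.card_sum]; lia)
  let a : X₂ ⊕ X₁ → TriMatrix ρ
    | .inl x => ⟨Ideal.Quotient.mk I₂ (PathAlgebra.vertex k x), 0, 0, 0, 0, 0⟩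
    | .inr y => ⟨0, 0, 0, 0, 0, Ideal.Quotient.mk I₁ (PathAlgebra.vertex k y)⟩
  -- The idempotent of the vertex `z` has coefficient `1` at `z` and `0` at `w`, also when the two
  -- vertices belong to different quivers.
  refine not_subsingleton_tpow ρ (vertexCoeff_one hI₁) (vertexCoeff_one hI₂)
    (z := z) (w := w) (a := a z) ?_ n hsub
  rcases z with x | y <;> rcases w with x' | y' <;>
    simp_all [a, outerFunctional, vertexCoeff_vertex]
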